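/- Conventions. An algebraic circuit over $\mathbb{C}$ is a finite directed acyclic graph whose leaves are labelled by variables or complex constants and whose internal nodes are labelled by $+$ or $\times$ (arbitrary fan-in); its size is the number of nodes, and $\operatorname{size}(f)$ is the least size of a circuit computing the polynomial $f$. $\operatorname{Perm}_m$ is the permanent of the generic $m\times m$ matrix. A family $(f_n)$, with $f_n\in\mathbb{C}[x_1,\dots,x_n]$, is in $\mathsf{VNP}$ if there are $k_n\in\mathbb{N}$ and polynomials $g_n(x_1,\dots,x_n,y_1,\dots,y_{k_n})$ with $f_n(x)=\sum_{y\in\{0,1\}^{k_n}}g_n(x,y)$ for all $n$ and a constant $c$ with $k_n,\deg g_n,\operatorname{size}(g_n)\le n^c$ for all large $n$. For a fixed $c$, let $\mathsf{VNP}^{(c)}_{\mathbb{C}}(n,d)$ be the set of $n$-variate complex polynomials $f$ of total degree at most $d$ that can be written as $f(x)=\sum_{y\in\{0,1\}^{k}}g(x,y)$ with $k,\deg g,\operatorname{size}(g)\le n^c$. For $N=\binom{n+d}{n}$, the coefficient vector of an $n$-variate polynomial of degree at most $d$ is a point of $\mathbb{C}^N$, and polynomials $P(x_1,\dots,x_N)$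 are evaluated at it. Theorem. Let $\varepsilon>0$ be a constant, and put $n=n(m)=\lfloor m^{\varepsilon/4}\rfloor$. Call $m$ hard if $\operatorname{size}(\operatorname{Perm}_m)\ge 2^{m^{\varepsilon}}$. (i) There is a constant $c$, depending only on $\varepsilon$, such that for all constants $a,k\in\mathbb{N}$ and every sufficiently large hard $m$ the following holds for $n=n(m)$, every $d\le n$ and $N=\binom{n+d}{n}$: every nonzero polynomial $P(x_1,\dots,x_N)$ over $\mathbb{C}$ of degree at most $N^a$ that vanishes on the coefficient vectors of all polynomials in $\mathsf{VNP}^{(c)}_{\mathbb{C}}(n,d)$ has $\operatorname{size}(P)\ge N^k$. In other words, equations of degree $\operatorname{poly}(N)$ have $\operatorname{size}(P)=N^{\omega(1)}$. (ii) Let $d_m\le n(m)$ and $N_m=\binom{n(m)+d_m}{n(m)}$, let $a$ be a constant, and let $P_m(x_1,\dots,x_{N_m})$ be nonzero polynomials over $\mathbb{C}$ with $\deg P_m\le N_m^a$ for all large $m$. Suppose that for every family $(f_n)$ in $\mathsf{VNP}$ and every sufficiently large hard $m$ with $\deg f_{n(m)}\le d_m$, the polynomial $P_m$ vanishes on the coefficient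 vector of $f_{n(m)}$. Then for every $k$ and every sufficiently large hard $m$, $\operatorname{size}(P_m)\ge N_m^k$; that is, $\operatorname{size}(P_m)=N_m^{\omega(1)}$ along the hard $m$. -/

import Mathlib

namespace VNPEquations

/-- A node of an algebraic circuit that comes after `k` earlier nodes in a topological order: a leaf
labelled by a variable or a constant, or a `+` / `×` gate of arbitrary fan-in whose set of children
consists of earlier nodes. (A gate without children computes the constant `0`, respectively `1`,
just as a leaf does.) -/
inductive Gate (σ : Type*) (K : Type*) (k : ℕ) where
  | var (x : σ)
  | const (a : K)
  | add (children : Finset (Fin k))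
  | mul (children : Finset (Fin k))

/-- An algebraic circuit over `K` in the variables `σ`: a finite directed acyclic graph, with its
nodes listed in a topological order, and a designated output node. `size` is the number of nodes. -/
structure Circuit (σ : Type*) (K : Type*) where
  size : ℕ
  gate : (i : Fin size) → Gate σ K i
  output : Fin size

/-- The polynomial computed at a node. -/
noncomputable def Circuit.value {σ K : Type*} [CommRing K] (C : Circuit σ K) (i : Fin C.size) :
    MvPolynomial σ K :=
  match C.gate i with
  | .var x => MvPolynomial.X x
  | .const a => MvPolynomial.C a
  | .add S => ∑ j ∈ S, C.value ⟨j, j.isLt.trans i.isLt⟩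
  | .mul S => ∏ j ∈ S, C.value ⟨j, j.isLt.trans i.isLt⟩
termination_by i.val

/-- The circuit computes the polynomial `f`. -/
def Circuit.Computes {σ K : Type*} [CommRing K] (C : Circuit σ K) (f : MvPolynomial σ K) : Prop :=
  C.value C.output = f

/-- `size(f) ≤ s`. -/
def HasCircuitOfSize {σ K : Type*} [CommRing K] (f : MvPolynomial σ K) (s : ℕ) : Prop :=
  ∃ C : Circuit σ K, C.Computes f ∧ C.size ≤ s

/-- `size(f) ≥ s`: every circuit that computes `f` has at least `s` nodes. -/
def RequiresSize {σ K : Type*} [CommRing K] (f : MvPolynomial σ K) (s : ℝ) : Prop :=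
  ∀ C : Circuit σ K, C.Computes f → s ≤ (C.size : ℝ)

/-- The permanent of the generic `m × m` matrix, a polynomial in `m ^ 2` variables. -/
noncomputable def permPoly (K : Type*) [CommRing K] (m : ℕ) : MvPolynomial (Fin m × Fin m) K :=
  (Matrix.mvPolynomialX (Fin m) (Fin m) K).permanent

/-- The exponential sum `∑_{b ∈ {0,1}^k} g(x, b)`. -/
noncomputable def boolSum {K : Type*} [CommRing K] {n k : ℕ}
    (g : MvPolynomial (Fin n ⊕ Fin k) K) : MvPolynomial (Fin n) K :=
  ∑ b : Fin k → Bool,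
    MvPolynomial.aeval (Sum.elim MvPolynomial.X (fun j => if b j then 1 else 0)) g

/-- The family `(f_n)` is in `VP`: degree and circuit size are at most `n ^ c` for large `n`. -/
def MemVP {K : Type*} [CommRing K] {σ : ℕ → Type} (f : (n : ℕ) → MvPolynomial (σ n) K) : Prop :=
  ∃ c : ℕ, ∀ᶠ n in Filter.atTop, (f n).totalDegree ≤ n ^ c ∧ HasCircuitOfSize (f n) (n ^ c)

/-- The family `(f_n)`, with `f_n` an `n`-variate polynomial, is in `VNP`. -/
def MemVNP {K : Type*} [CommRing K] (f : (n : ℕ) → MvPolynomial (Fin n) K) : Prop :=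
  ∃ (k : ℕ → ℕ) (g : (n : ℕ) → MvPolynomial (Fin n ⊕ Fin (k n)) K),
    MemVP g ∧ (∃ c : ℕ, ∀ᶠ n in Filter.atTop, k n ≤ n ^ c) ∧ ∀ n, f n = boolSum (g n)

/-- The polynomials in `VNP(n, d)` with polynomial bound `n ^ c`: the `n`-variate polynomials of
total degree at most `d` that are exponential sums over at most `n ^ c` auxiliary variables of a
polynomial whose degree and circuit size are at most `n ^ c`. -/
def VNPSlice (K : Type*) [CommRing K] (c n d : ℕ) : Set (MvPolynomial (Fin n) K) :=
  {f | f.totalDegree ≤ d ∧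
    ∃ (k : ℕ) (g : MvPolynomial (Fin n ⊕ Fin k) K),
      k ≤ n ^ c ∧ g.totalDegree ≤ n ^ c ∧ HasCircuitOfSize g (n ^ c) ∧ f = boolSum g}

/-- The exponent vectors of the monomials in `n` variables of total degree at most `d`; there are
`(n + d).choose n` of them. -/
abbrev MonIdx (n d : ℕ) : Type := {e : Fin n →₀ ℕ // e.degree ≤ d}

/-- The coefficient vector of an `n`-variate polynomial of degree at most `d`. -/
def coeffVec {K : Type*} [CommRing K] {n : ℕ} (d : ℕ) (f : MvPolynomial (Fin n) K) :
    MonIdx n d → K :=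
  fun e => f.coeff e.1

/-- `P` vanishes at the coefficient vector of `f`. -/
def VanishesAt {K : Type*} [CommRing K] {n d : ℕ} (P : MvPolynomial (MonIdx n d) K)
    (f : MvPolynomial (Fin n) K) : Prop :=
  MvPolynomial.eval (coeffVec d f) P = 0

/-- `Perm_m` over `ℂ` requires circuits of size `2 ^ (m ^ ε)`. -/
def PermHard (ε : ℝ) (m : ℕ) : Prop :=
  RequiresSize (permPoly ℂ m) ((2 : ℝ) ^ ((m : ℝ) ^ ε))

/-- The number of variables `n = m ^ (ε / 4)`, rounded down. -/
noncomputable def numVars (ε : ℝ) (m : ℕ) : ℕ := ⌊(m : ℝ) ^ (ε / 4)⌋₊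

end VNPEquations

/-!
The proof is by the Kabanets–Impagliazzo generator. Take a Reed–Solomon design: the monomial `e`
is assigned the `m ^ 2` evaluations of the polynomial `∑ l, e l * X ^ l` over a prime field
`ZMod q`, so that two monomials agree in fewer than `n` places. For every table `α`, the polynomial
whose coefficient of `e` is the permanent of the matrix of entries `α s (∑ l, e l * x s ^ l)` is
an exponential sum of small circuits, because a one-hot encoding of `e` by Boolean variables turns
the evaluation of the design and the table lookup into univariate interpolation at an integer.
Hence an equation `P` for `VNP` vanishes at all these coefficient vectors.

Replacing the coordinates of `P` one at a time by values of the generator, there is a first one at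
which `P` becomes zero, and fixing the variables outside the support of this coordinate gives
`Q (y, x) ≠ 0` with `Q (Perm x, x) = 0`. The other coordinates depend on fewer than `n` of the
variables `x`, so `Q` has a small circuit. Newton iteration then finds a small circuit for the root
`Perm`, which contradicts hardness. The root may be multiple, but it is a simple root of some
derivative of `Q` with respect to `y`.
-/

namespace VNPEquations

section Circuits

open Finset

variable {σ τ ι K : Type*} [CommRing K]

/-- The polynomial computed at a node whose predecessors compute `v`. -/
noncomputable def Gate.eval {k : ℕ} (g : Gate σ K k) (v : Fin k → MvPolynomial σ K) :
    MvPolynomial σ K :=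
  match g with
  | .var x => MvPolynomial.X x
  | .const a => MvPolynomial.C a
  | .add S => ∑ j ∈ S, v j
  | .mul S => ∏ j ∈ S, v j

/-- The first `t` terms of `v` are the successive values of a straight-line program. Indexing by
`ℕ` rather than `Fin t` makes concatenation of programs free of casts. -/
def IsStraightLine (v : ℕ → MvPolynomial σ K) (t : ℕ) : Prop :=
  ∀ i < t, ∃ g : Gate σ K i, g.eval (fun j => v j) = v i

theorem Circuit.value_eq_eval (C : Circuit σ K) (i : Fin C.size) :
    C.value i = (C.gate i).eval fun j => C.value ⟨j, j.isLt.trans i.isLt⟩ := by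
  rw [Circuit.value]
  cases C.gate i <;> rfl

theorem Circuit.isStraightLine (C : Circuit σ K) :
    IsStraightLine (fun i => if h : i < C.size then C.value ⟨i, h⟩ else 0) C.size := by
  intro i hi
  refine ⟨C.gate ⟨i, hi⟩, ?_⟩
  simp only [dif_pos hi]
  rw [C.value_eq_eval]
  congr 1
  exact funext fun j => dif_pos (j.isLt.trans hi)

theorem IsStraightLine.exists_circuit {v : ℕ → MvPolynomial σ K} {t : ℕ}
    (h : IsStraightLine v t) (o : Fin t) : ∃ C : Circuit σ K, C.size = t ∧ C.Computes (v o) := by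
  choose g hg using fun i : Fin t => h i i.isLt
  have value_eq (i : ℕ) (hi : i < t) : Circuit.value ⟨t, g, o⟩ ⟨i, hi⟩ = v i := by
    induction i using Nat.strong_induction_on with
    | _ i ih =>
      rw [Circuit.value_eq_eval, ← hg ⟨i, hi⟩]
      congr 1
      exact funext fun j => ih j j.isLt (j.isLt.trans hi)
  exact ⟨⟨t, g, o⟩, rfl, value_eq o o.isLt⟩

theorem hasCircuitOfSize_iff {f : MvPolynomial σ K} {s : ℕ} :
    HasCircuitOfSize f s ↔ ∃ (v : ℕ → MvPolynomial σ K) (t : ℕ), IsStraightLine v t ∧ t ≤ s ∧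
      ∃ i < t, v i = f := by
  constructor
  · rintro ⟨C, hC, hs⟩
    exact ⟨_, C.size, C.isStraightLine, hs, C.output, C.output.isLt,
      (dif_pos C.output.isLt).trans hC⟩
  · rintro ⟨v, t, hv, hts, i, hi, rfl⟩
    obtain ⟨C, rfl, hC⟩ := hv.exists_circuit ⟨i, hi⟩
    exact ⟨C, hC, hts⟩

theorem HasCircuitOfSize.mono {f : MvPolynomial σ K} {s t : ℕ} (h : HasCircuitOfSize f s)
    (hst : s ≤ t) : HasCircuitOfSize f t :=
  let ⟨C, hC, hs⟩ := h
  ⟨C, hC, hs.trans hst⟩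

/-- The first `t` instructions of the program `v`, followed by the program `w`. -/
def appendProgram {A : Type*} (v : ℕ → A) (t : ℕ) (w : ℕ → A) : ℕ → A :=
  fun i => if i < t then v i else w (i - t)

theorem appendProgram_of_lt {A : Type*} {v w : ℕ → A} {t i : ℕ} (h : i < t) :
    appendProgram v t w i = v i :=
  if_pos h

theorem appendProgram_add {A : Type*} {v w : ℕ → A} {t : ℕ} (i : ℕ) :
    appendProgram v t w (i + t) = w i := by
  simp [appendProgram]

theorem IsStraightLine.append_subst {v : ℕ → MvPolynomial τ K} {w : ℕ → MvPolynomial σ K}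
    {t s : ℕ} (hv : IsStraightLine v t) (hw : IsStraightLine w s) (g : σ → MvPolynomial τ K)
    (hg : ∀ x, (∃ y, g x = MvPolynomial.X y) ∨ ∃ j < t, v j = g x) :
    IsStraightLine (appendProgram v t fun i => MvPolynomial.aeval g (w i)) (t + s) := by
  intro i hi
  rcases lt_or_ge i t with hit | hti
  · obtain ⟨G, hG⟩ := hv i hit
    refine ⟨G, ?_⟩
    rw [appendProgram_of_lt hit, ← hG]
    congr 1
    exact funext fun j => appendProgram_of_lt (j.isLt.trans hit)
  obtain ⟨k, rfl⟩ := Nat.exists_eq_add_of_le' hti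
  obtain ⟨G, hG⟩ := hw k (by omega)
  rw [appendProgram_add, ← hG]
  cases G with
  | var x =>
    rcases hg x with ⟨y, hy⟩ | ⟨j, hj, hjx⟩
    · exact ⟨.var y, by simp [Gate.eval, hy]⟩
    · exact ⟨.add {⟨j, hj.trans_le hti⟩}, by simp [Gate.eval, appendProgram_of_lt hj, hjx]⟩
  | const a => exact ⟨.const a, by simp [Gate.eval, MvPolynomial.algebraMap_eq]⟩
  | add S => exact ⟨.add (S.map (Fin.addNatEmb t)), by simp [Gate.eval, appendProgram_add]⟩
  | mul S => exact ⟨.mul (S.map (Fin.addNatEmb t)), by simp [Gate.eval, appendProgram_add]⟩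

theorem IsStraightLine.append {v w : ℕ → MvPolynomial σ K} {t s : ℕ}
    (hv : IsStraightLine v t) (hw : IsStraightLine w s) :
    IsStraightLine (appendProgram v t w) (t + s) := by
  simpa using hv.append_subst hw MvPolynomial.X fun x => Or.inl ⟨x, rfl⟩

theorem IsStraightLine.hasCircuitOfSize_eval {v : ℕ → MvPolynomial σ K} {t : ℕ}
    (hv : IsStraightLine v t) (g : Gate σ K t) :
    HasCircuitOfSize (g.eval fun j => v j) (t + 1) := by
  have eval_append {i : ℕ} (hi : i ≤ t) (G : Gate σ K i) :
      (G.eval fun j => appendProgram v t (fun _ => g.eval fun j => v j) j) =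
        G.eval fun j => v j := by
    congr 1
    exact funext fun j => appendProgram_of_lt (j.isLt.trans_le hi)
  refine hasCircuitOfSize_iff.mpr ⟨appendProgram v t fun _ => g.eval fun j => v j, t + 1,
    fun i hi => ?_, le_rfl, t, t.lt_succ_self, by simpa using appendProgram_add 0⟩
  rcases Nat.lt_succ_iff_lt_or_eq.mp hi with hit | rfl
  · obtain ⟨G, hG⟩ := hv i hit
    exact ⟨G, by rw [eval_append hit.le, appendProgram_of_lt hit, hG]⟩
  · exact ⟨g, by rw [eval_append le_rfl]; simp [appendProgram]⟩

/-- The indices are kept distinct because the children of a gate form a set: equal summands must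
be computed at different nodes. -/
theorem exists_joint_program {S : Finset ι} {f : ι → MvPolynomial σ K} {s : ℕ}
    (h : ∀ i ∈ S, HasCircuitOfSize (f i) s) :
    ∃ (v : ℕ → MvPolynomial σ K) (t : ℕ) (idx : S ↪ Fin t), IsStraightLine v t ∧
      t ≤ #S * s ∧ ∀ i, v (idx i) = f i := by
  classical
  suffices ∃ (v : ℕ → MvPolynomial σ K) (t : ℕ) (idx : ι → ℕ), IsStraightLine v t ∧
      t ≤ #S * s ∧ (∀ i ∈ S, idx i < t ∧ v (idx i) = f i) ∧ Set.InjOn idx S by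
    obtain ⟨v, t, idx, hv, ht, hidx, hinj⟩ := this
    exact ⟨v, t, ⟨fun i => ⟨idx i, (hidx i i.2).1⟩, fun i j hij =>
      Subtype.ext (hinj i.2 j.2 (Fin.mk.inj hij))⟩, hv, ht, fun i => (hidx i i.2).2⟩
  induction S using Finset.induction_on with
  | empty => exact ⟨0, 0, 0, fun i hi => absurd hi i.not_lt_zero, by simp⟩
  | insert a S ha ih =>
    obtain ⟨v, t, idx, hv, ht, hidx, hinj⟩ := ih fun i hi => h i (mem_insert_of_mem hi)
    obtain ⟨w, r, hw, hr, o, ho, hwo⟩ := hasCircuitOfSize_iff.mp (h a (mem_insert_self a S))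
    have update_of_mem {i : ι} (hi : i ∈ S) : Function.update idx a (o + t) i = idx i :=
      Function.update_of_ne (ne_of_mem_of_not_mem hi ha) _ _
    refine ⟨appendProgram v t w, t + r, Function.update idx a (o + t), hv.append hw, ?_, ?_, ?_⟩
    · rw [card_insert_of_notMem ha, add_mul]
      omega
    · refine forall_mem_insert _ _ _ |>.mpr ⟨?_, fun i hi => ?_⟩
      · rw [Function.update_self, appendProgram_add]
        exact ⟨by omega, hwo⟩
      · rw [update_of_mem hi, appendProgram_of_lt (hidx i hi).1]
        exact ⟨(hidx i hi).1.trans_le (by omega), (hidx i hi).2⟩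
    · rw [coe_insert, Set.injOn_insert ha, Function.update_self]
      refine ⟨hinj.congr fun i hi => (update_of_mem hi).symm, ?_⟩
      rintro ⟨i, hi, hio⟩
      rw [update_of_mem hi] at hio
      have := (hidx i hi).1
      omega

theorem hasCircuitOfSize_X (x : σ) : HasCircuitOfSize (MvPolynomial.X x : MvPolynomial σ K) 1 :=
  IsStraightLine.hasCircuitOfSize_eval (v := 0) (t := 0) (fun i hi => absurd hi i.not_lt_zero)
    (.var x)

theorem hasCircuitOfSize_C (a : K) : HasCircuitOfSize (MvPolynomial.C a : MvPolynomial σ K) 1 :=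
  IsStraightLine.hasCircuitOfSize_eval (v := 0) (t := 0) (fun i hi => absurd hi i.not_lt_zero)
    (.const a)

theorem HasCircuitOfSize.sum {S : Finset ι} {f : ι → MvPolynomial σ K} {s : ℕ}
    (h : ∀ i ∈ S, HasCircuitOfSize (f i) s) : HasCircuitOfSize (∑ i ∈ S, f i) (#S * s + 1) := by
  obtain ⟨v, t, idx, hv, ht, hidx⟩ := exists_joint_program h
  have := hv.hasCircuitOfSize_eval (.add (univ.map idx))
  simp only [Gate.eval, sum_map, hidx] at this
  exact sum_coe_sort S f ▸ this.mono (Nat.succ_le_succ ht)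

theorem HasCircuitOfSize.prod {S : Finset ι} {f : ι → MvPolynomial σ K} {s : ℕ}
    (h : ∀ i ∈ S, HasCircuitOfSize (f i) s) : HasCircuitOfSize (∏ i ∈ S, f i) (#S * s + 1) := by
  obtain ⟨v, t, idx, hv, ht, hidx⟩ := exists_joint_program h
  have := hv.hasCircuitOfSize_eval (.mul (univ.map idx))
  simp only [Gate.eval, prod_map, hidx] at this
  exact prod_coe_sort S f ▸ this.mono (Nat.succ_le_succ ht)

theorem HasCircuitOfSize.aeval [Fintype σ] {f : MvPolynomial σ K} {s t : ℕ}
    (hf : HasCircuitOfSize f s) {g : σ → MvPolynomial τ K} (hg : ∀ x, HasCircuitOfSize (g x) t) :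
    HasCircuitOfSize (MvPolynomial.aeval g f) (Fintype.card σ * t + s) := by
  obtain ⟨w, r, hw, hr, o, ho, rfl⟩ := hasCircuitOfSize_iff.mp hf
  obtain ⟨v, u, idx, hv, hu, hidx⟩ := exists_joint_program (S := univ) fun x _ => hg x
  refine hasCircuitOfSize_iff.mpr ⟨_, u + r, hv.append_subst hw g fun x => Or.inr
    ⟨idx ⟨x, mem_univ x⟩, Fin.isLt _, hidx _⟩, add_le_add hu hr, o + u, by omega,
    appendProgram_add o⟩

end Circuits

section Complexity

open Finset

variable {σ τ ι K : Type*} [CommRing K]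

theorem totalDegree_aeval_le {f : MvPolynomial σ K} {D B : ℕ} (hf : f.totalDegree ≤ D)
    {g : σ → MvPolynomial τ K} (hg : ∀ x, (g x).totalDegree ≤ B) :
    (MvPolynomial.aeval g f).totalDegree ≤ D * B := by
  rw [MvPolynomial.aeval_def, MvPolynomial.eval₂_eq]
  refine MvPolynomial.totalDegree_finsetSum_le fun d hd => ?_
  refine (MvPolynomial.totalDegree_mul _ _).trans ?_
  rw [MvPolynomial.algebraMap_eq, MvPolynomial.totalDegree_C, zero_add]
  refine (MvPolynomial.totalDegree_finsetProd _ _).trans ?_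
  calc ∑ i ∈ d.support, (g i ^ d i).totalDegree ≤ ∑ i ∈ d.support, d i * B :=
        sum_le_sum fun i _ => (MvPolynomial.totalDegree_pow _ _).trans
          (Nat.mul_le_mul_left _ (hg i))
    _ = (∑ i ∈ d.support, d i) * B := (sum_mul _ _ _).symm
    _ ≤ D * B := Nat.mul_le_mul_right _ ((MvPolynomial.le_totalDegree hd).trans hf)

/-- Degree and circuit size are at most `B ^ k`. With `B` fixed, the rules below only add constants
to the exponent `k`, so that polynomial bounds are tracked by one number. -/
structure IsSmall (B k : ℕ) (f : MvPolynomial σ K) : Prop where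
  totalDegree_le : f.totalDegree ≤ B ^ k
  hasCircuitOfSize : HasCircuitOfSize f (B ^ k)

namespace IsSmall

variable {B k l : ℕ} {f g : MvPolynomial σ K}

theorem mono (hB : 2 ≤ B) (hf : IsSmall B k f) (hkl : k ≤ l) : IsSmall B l f :=
  have pow_le := Nat.pow_le_pow_right (by omega) hkl
  ⟨hf.totalDegree_le.trans pow_le, hf.hasCircuitOfSize.mono pow_le⟩

theorem pow_iff : IsSmall (B ^ l) k f ↔ IsSmall B (l * k) f :=
  ⟨fun hf => ⟨pow_mul B l k ▸ hf.totalDegree_le, pow_mul B l k ▸ hf.hasCircuitOfSize⟩,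
    fun hf => ⟨pow_mul B l k ▸ hf.totalDegree_le, pow_mul B l k ▸ hf.hasCircuitOfSize⟩⟩

protected theorem X [Nontrivial K] (x : σ) : IsSmall B 0 (MvPolynomial.X x : MvPolynomial σ K) :=
  ⟨by simp, by simpa using hasCircuitOfSize_X x⟩

protected theorem C (a : K) : IsSmall B 0 (MvPolynomial.C a : MvPolynomial σ K) :=
  ⟨by simp, by simpa using hasCircuitOfSize_C a⟩

theorem mul_pow_add_one_le (hB : 2 ≤ B) {s : ℕ} (hs : s ≤ B) : s * B ^ k + 1 ≤ B ^ (k + 2) :=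
  calc s * B ^ k + 1 ≤ B * B ^ k + B * B ^ k := by
        gcongr
        exact Nat.mul_pos (by omega) (Nat.pow_pos (by omega))
    _ = 2 * B * B ^ k := by ring
    _ ≤ B * B * B ^ k := by gcongr
    _ = B ^ (k + 2) := by ring

protected theorem sum (hB : 2 ≤ B) {S : Finset ι} {f : ι → MvPolynomial σ K} (hS : #S ≤ B)
    (h : ∀ i ∈ S, IsSmall B k (f i)) : IsSmall B (k + 2) (∑ i ∈ S, f i) where
  totalDegree_le := MvPolynomial.totalDegree_finsetSum_le fun i hi =>
    (h i hi).totalDegree_le.trans (Nat.pow_le_pow_right (by omega) (by omega))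
  hasCircuitOfSize := (HasCircuitOfSize.sum fun i hi => (h i hi).hasCircuitOfSize).mono
    (mul_pow_add_one_le hB hS)

protected theorem prod (hB : 2 ≤ B) {S : Finset ι} {f : ι → MvPolynomial σ K} (hS : #S ≤ B)
    (h : ∀ i ∈ S, IsSmall B k (f i)) : IsSmall B (k + 2) (∏ i ∈ S, f i) where
  totalDegree_le := by
    refine (MvPolynomial.totalDegree_finsetProd _ _).trans ?_
    refine (sum_le_card_nsmul S _ _ fun i hi => (h i hi).totalDegree_le).trans ?_
    exact (Nat.le_succ _).trans (mul_pow_add_one_le hB hS)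
  hasCircuitOfSize := (HasCircuitOfSize.prod fun i hi => (h i hi).hasCircuitOfSize).mono
    (mul_pow_add_one_le hB hS)

protected theorem pow (hB : 2 ≤ B) (hf : IsSmall B k f) {j : ℕ} (hj : j ≤ B) :
    IsSmall B (k + 2) (f ^ j) := by
  simpa using IsSmall.prod (S := range j) (f := fun _ => f) hB (by simpa using hj) fun _ _ => hf

protected theorem add (hB : 2 ≤ B) (hf : IsSmall B k f) (hg : IsSmall B k g) :
    IsSmall B (k + 2) (f + g) := by
  simpa using IsSmall.sum (S := univ) (f := ![f, g]) hB (by simpa using hB)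
    (by simp [Fin.forall_fin_two, hf, hg])

protected theorem mul (hB : 2 ≤ B) (hf : IsSmall B k f) (hg : IsSmall B k g) :
    IsSmall B (k + 2) (f * g) := by
  simpa using IsSmall.prod (S := univ) (f := ![f, g]) hB (by simpa using hB)
    (by simp [Fin.forall_fin_two, hf, hg])

theorem C_mul (hB : 2 ≤ B) (a : K) (hf : IsSmall B k f) :
    IsSmall B (k + 2) (MvPolynomial.C a * f) :=
  ((IsSmall.C a).mono hB k.zero_le).mul hB hf

protected theorem sub (hB : 2 ≤ B) (hf : IsSmall B k f) (hg : IsSmall B k g) :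
    IsSmall B (k + 4) (f - g) := by
  simpa [sub_eq_add_neg] using (hf.mono hB (k.le_add_right 2)).add hB (hg.C_mul hB (-1))

protected theorem aeval [Fintype σ] (hB : 2 ≤ B) (hσ : Fintype.card σ ≤ B) (hf : IsSmall B k f)
    {g : σ → MvPolynomial τ K} (hg : ∀ x, IsSmall B l (g x)) :
    IsSmall B (k + l + 2) (MvPolynomial.aeval g f) where
  totalDegree_le := (totalDegree_aeval_le hf.totalDegree_le fun x => (hg x).totalDegree_le).trans
    (by rw [← pow_add]; exact Nat.pow_le_pow_right (by omega) (by omega))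
  hasCircuitOfSize := by
    refine (hf.hasCircuitOfSize.aeval fun x => (hg x).hasCircuitOfSize).mono ?_
    calc Fintype.card σ * B ^ l + B ^ k ≤ B * B ^ (k + l) + B * B ^ (k + l) := by
          gcongr ?_ * B ^ ?_ + ?_
          · omega
          · omega
          · exact (Nat.pow_le_pow_right (by omega) (by omega)).trans
              (Nat.le_mul_of_pos_left _ (by omega))
      _ = 2 * B * B ^ (k + l) := by ring
      _ ≤ B * B * B ^ (k + l) := by gcongr
      _ = B ^ (k + l + 2) := by ring

theorem polynomial_aeval (hB : 2 ≤ B) (hf : IsSmall B k f) {p : Polynomial K}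
    (hp : p.natDegree < B) : IsSmall B (k + 6) (Polynomial.aeval f p) := by
  rw [Polynomial.aeval_eq_sum_range' hp]
  refine IsSmall.sum hB (by simp) fun i hi => ?_
  rw [MvPolynomial.smul_eq_C_mul]
  exact (hf.pow hB (mem_range.mp hi).le).C_mul hB _

end IsSmall

end Complexity

section Interpolation

open Finset Polynomial

variable {σ K : Type*} [Field K] [CharZero K]

theorem sum_lagrangeBasis_coeff_mul_pow {D k : ℕ} (hk : k ≤ D) (i : ℕ) :
    ∑ l ∈ range (D + 1), (Lagrange.basis (range (D + 1)) (Nat.cast : ℕ → K) l).coeff i *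
      (l : K) ^ k = if i = k then 1 else 0 := by
  have deg_lt : (X ^ k : K[X]).degree < #(range (D + 1)) := by
    rw [degree_X_pow, card_range]
    exact_mod_cast Nat.lt_succ_of_le hk
  rw [← coeff_X_pow, Lagrange.eq_interpolate (v := (Nat.cast : ℕ → K)) Nat.cast_injective.injOn
    deg_lt, Lagrange.interpolate_apply, finsetSum_coeff]
  exact sum_congr rfl fun l _ => by rw [coeff_C_mul, eval_pow, eval_X, mul_comm]

theorem coeff_eq_sum_lagrangeBasis_coeff_mul_eval {R : Type*} [CommRing R] [Algebra K R] {D : ℕ}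
    {p : R[X]} (hp : p.natDegree ≤ D) (i : ℕ) :
    p.coeff i = ∑ l ∈ range (D + 1), algebraMap K R
      ((Lagrange.basis (range (D + 1)) (Nat.cast : ℕ → K) l).coeff i) * p.eval (l : R) := by
  have sum_eq {k : ℕ} (hk : k ∈ range (D + 1)) := congrArg (algebraMap K R)
    (sum_lagrangeBasis_coeff_mul_pow (K := K) (Nat.le_of_lt_succ (mem_range.mp hk)) i)
  simp only [map_sum, map_mul, map_pow, map_natCast, apply_ite (algebraMap K R), map_one,
    map_zero] at sum_eq
  calc p.coeff i = ∑ k ∈ range (D + 1), p.coeff k * if i = k then 1 else 0 := by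
        simp only [mul_ite, mul_one, mul_zero, sum_ite_eq, mem_range]
        split_ifs with h
        · rfl
        · exact coeff_eq_zero_of_natDegree_lt (by omega)
    _ = _ := by
        rw [sum_congr rfl fun k hk => by rw [← sum_eq hk, mul_sum], sum_comm]
        refine sum_congr rfl fun l _ => ?_
        rw [eval_eq_sum_range' (Nat.lt_succ_of_le hp), mul_sum]
        exact sum_congr rfl fun k _ => mul_left_comm _ _ _

theorem isSmall_sum_coeff {B k : ℕ} (hB : 2 ≤ B) {F : (MvPolynomial σ K)[X]}
    (hF : F.natDegree < B) (h : ∀ l : ℕ, IsSmall B k (F.eval (l : MvPolynomial σ K)))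
    (S : Finset ℕ) : IsSmall B (k + 4) (∑ i ∈ S, F.coeff i) := by
  obtain ⟨D, rfl⟩ : ∃ D, B = D + 1 := Nat.exists_eq_succ_of_ne_zero (by omega)
  simp only [coeff_eq_sum_lagrangeBasis_coeff_mul_eval (K := K) (Nat.le_of_lt_succ hF)]
  rw [sum_comm]
  refine IsSmall.sum hB (card_range _).le fun l _ => ?_
  rw [← sum_mul, ← map_sum, MvPolynomial.algebraMap_eq]
  exact (h l).C_mul hB _

end Interpolation

section Roots

open Finset Polynomial

variable {τ K : Type*}

theorem exists_hasseDeriv_eval_eq_zero_and_succ_ne_zero {R : Type*} [CommRing R] {q : R[X]}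
    (hq : q ≠ 0) {p : R} (hp : q.eval p = 0) :
    ∃ i, (hasseDeriv i q).eval p = 0 ∧ (hasseDeriv (i + 1) q).eval p ≠ 0 := by
  simp only [← taylor_coeff]
  have taylor_ne : taylor p q ≠ 0 := (map_ne_zero_iff _ (taylor_injective p)).mpr hq
  have trailing_ne : (taylor p q).coeff (taylor p q).natTrailingDegree ≠ 0 :=
    trailingCoeff_nonzero_iff_nonzero.mpr taylor_ne
  obtain ⟨i, hi⟩ : ∃ i, (taylor p q).natTrailingDegree = i + 1 :=
    Nat.exists_eq_succ_of_ne_zero fun h0 => trailing_ne (by rw [h0, taylor_coeff_zero, hp])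
  exact ⟨i, coeff_eq_zero_of_lt_natTrailingDegree (by omega), hi ▸ trailing_ne⟩

theorem derivative_hasseDeriv {R : Type*} [CommRing R] (i : ℕ) (q : R[X]) :
    derivative (hasseDeriv i q) = (i + 1) • hasseDeriv (i + 1) q := by
  simpa [add_comm 1 i, add_mul] using LinearMap.congr_fun (hasseDeriv_comp (R := R) 1 i) q

/-- One step of Newton's iteration, with a truncated geometric series in place of the inverse of
the derivative. -/
theorem newton_step {R : Type*} [CommRing R] {I : Ideal R} (q : R[X]) {p r d : R}
    (hp : q.eval p = 0) (hd : 1 - d * q.derivative.eval p ∈ I) {k M : ℕ} (hk : 1 ≤ k)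
    (hkM : k ≤ M) (hr : r - p ∈ I ^ k) :
    r - q.eval r * ∑ j ∈ range M, d * (1 - d * q.derivative.eval r) ^ j - p ∈ I ^ (2 * k) := by
  obtain ⟨S, hS⟩ : ∃ S, q.eval p = q.eval r + q.derivative.eval r * (p - r) + S * (p - r) ^ 2 := by
    obtain ⟨S, h⟩ := q.binomExpansion r (p - r)
    exact ⟨S, by simpa using h⟩
  set y := q.derivative.eval r
  have geom_sum : (∑ j ∈ range M, d * (1 - d * y) ^ j) * y = 1 - (1 - d * y) ^ M := by
    rw [← mul_neg_geom_sum (1 - d * y) M, ← mul_sum]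
    ring
  have one_sub_mem : 1 - d * y ∈ I := by
    have sub_mem : y - q.derivative.eval p ∈ I :=
      I.mem_of_dvd (sub_dvd_eval_sub r p _) (Ideal.pow_le_self (by omega) hr)
    rw [show 1 - d * y = 1 - d * q.derivative.eval p - d * (y - q.derivative.eval p) by ring]
    exact I.sub_mem hd (I.mul_mem_left d sub_mem)
  have error_eq : r - q.eval r * ∑ j ∈ range M, d * (1 - d * y) ^ j - p =
      (1 - d * y) ^ M * (r - p) +
        S * (∑ j ∈ range M, d * (1 - d * y) ^ j) * ((r - p) * (r - p)) := by
    rw [hp] at hS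
    linear_combination (∑ j ∈ range M, d * (1 - d * y) ^ j) * hS - (r - p) * geom_sum
  rw [error_eq, two_mul, pow_add]
  exact Ideal.add_mem _
    (Ideal.mul_mem_mul (Ideal.pow_le_pow_right hkM (Ideal.pow_mem_pow one_sub_mem M)) hr)
    (Ideal.mul_mem_left _ _ (Ideal.mul_mem_mul hr hr))

theorem natDegree_aeval_le {σ R : Type*} [CommRing K] [CommRing R] [Algebra K R]
    {f : MvPolynomial σ K} {D : ℕ} (hf : f.totalDegree ≤ D) {g : σ → R[X]}
    (hg : ∀ x, (g x).natDegree ≤ 1) : (MvPolynomial.aeval g f).natDegree ≤ D := by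
  rw [MvPolynomial.aeval_def, MvPolynomial.eval₂_eq]
  refine natDegree_sum_le_of_forall_le _ _ fun d hd => ?_
  refine natDegree_mul_le.trans ?_
  rw [Polynomial.algebraMap_apply, natDegree_C, zero_add]
  refine (natDegree_prod_le _ _).trans ?_
  calc ∑ i ∈ d.support, (g i ^ d i).natDegree ≤ ∑ i ∈ d.support, d i :=
        sum_le_sum fun i _ => natDegree_pow_le.trans
          ((Nat.mul_le_mul_left _ (hg i)).trans (mul_one _).le)
    _ ≤ D := (MvPolynomial.le_totalDegree hd).trans hf

/-- Substitution of `r` for the distinguished variable. -/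
noncomputable def substNone [CommRing K] (r : MvPolynomial τ K) :
    MvPolynomial (Option τ) K →ₐ[K] MvPolynomial τ K :=
  MvPolynomial.aeval fun o => o.elim r MvPolynomial.X

/-- The image of `Q(y, x)` in `K[y, x][T]` under the shift `y ↦ y + T`. -/
noncomputable def shiftNone [CommRing K] :
    MvPolynomial (Option τ) K →ₐ[K] (MvPolynomial (Option τ) K)[X] :=
  MvPolynomial.aeval fun o =>
    o.elim (C (MvPolynomial.X none) + X) fun x => C (MvPolynomial.X (some x))

section CommRing

variable [CommRing K]

theorem eval_optionEquivLeft (Q : MvPolynomial (Option τ) K) (r : MvPolynomial τ K) :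
    (MvPolynomial.optionEquivLeft K τ Q).eval r = substNone r Q := by
  have : ((Polynomial.aeval r).restrictScalars K).comp
      (MvPolynomial.optionEquivLeft K τ).toAlgHom = substNone r := by
    apply MvPolynomial.algHom_ext
    rintro (_ | i) <;> simp [substNone]
  simpa [Polynomial.coe_aeval_eq_eval] using DFunLike.congr_fun this Q

theorem map_shiftNone (Q : MvPolynomial (Option τ) K) (r : MvPolynomial τ K) :
    (shiftNone Q).map (substNone r : _ →+* MvPolynomial τ K) =
      taylor r (MvPolynomial.optionEquivLeft K τ Q) := by
  have : (Polynomial.mapAlgHom (substNone r)).comp shiftNone =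
      ((taylorAlgHom r).restrictScalars K).comp (MvPolynomial.optionEquivLeft K τ).toAlgHom := by
    apply MvPolynomial.algHom_ext
    rintro (_ | i) <;> simp [substNone, shiftNone, add_comm]
  simpa using DFunLike.congr_fun this Q

theorem substNone_coeff_shiftNone (Q : MvPolynomial (Option τ) K) (r : MvPolynomial τ K) (i : ℕ) :
    substNone r ((shiftNone Q).coeff i) =
      (hasseDeriv i (MvPolynomial.optionEquivLeft K τ Q)).eval r := by
  rw [← taylor_coeff, ← map_shiftNone, coeff_map]
  rfl

theorem eval_shiftNone (Q : MvPolynomial (Option τ) K) (l : ℕ) :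
    (shiftNone Q).eval (l : MvPolynomial (Option τ) K) =
      MvPolynomial.aeval (fun o : Option τ => o.elim
        (MvPolynomial.X none + MvPolynomial.C (l : K)) fun x => MvPolynomial.X (some x)) Q := by
  have : ((Polynomial.aeval (l : MvPolynomial (Option τ) K)).restrictScalars K).comp shiftNone =
      MvPolynomial.aeval (fun o : Option τ => o.elim
        (MvPolynomial.X none + MvPolynomial.C (l : K)) fun x => MvPolynomial.X (some x)) := by
    apply MvPolynomial.algHom_ext
    rintro (_ | i) <;> simp [shiftNone]
  simpa [Polynomial.coe_aeval_eq_eval] using DFunLike.congr_fun this Q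

theorem natDegree_shiftNone_le (Q : MvPolynomial (Option τ) K) :
    (shiftNone Q).natDegree ≤ Q.totalDegree := by
  refine natDegree_aeval_le le_rfl ?_
  rintro (_ | x)
  · exact natDegree_add_le_of_degree_le ((natDegree_C _).trans_le zero_le_one) natDegree_X_le
  · exact (natDegree_C _).trans_le zero_le_one

theorem IsSmall.substNone [Nontrivial K] [Fintype τ] {B k l : ℕ} (hB : 2 ≤ B)
    (hτ : Fintype.card τ + 1 ≤ B) {Q : MvPolynomial (Option τ) K} (hQ : IsSmall B k Q)
    {r : MvPolynomial τ K} (hr : IsSmall B l r) :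
    IsSmall B (k + l + 2) (substNone r Q) := by
  refine hQ.aeval hB (by simpa using hτ) ?_
  rintro (_ | x)
  · exact hr
  · exact (IsSmall.X x).mono hB l.zero_le

/-- The polynomial `y - Q₁ * ∑_{j < M} a * (1 - b * Q₂) ^ j` whose substitution instances are the
steps of Newton's iteration. -/
noncomputable def newtonPoly (Q₁ Q₂ : MvPolynomial (Option τ) K) (a b : K) (M : ℕ) :
    MvPolynomial (Option τ) K :=
  MvPolynomial.X none - Q₁ * ∑ j ∈ range M,
    MvPolynomial.C a * (MvPolynomial.C 1 - MvPolynomial.C b * Q₂) ^ j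

theorem substNone_newtonPoly (Q₁ Q₂ : MvPolynomial (Option τ) K) (a b : K) (M : ℕ)
    (r : MvPolynomial τ K) :
    substNone r (newtonPoly Q₁ Q₂ a b M) = r - substNone r Q₁ * ∑ j ∈ range M,
      MvPolynomial.C a * (1 - MvPolynomial.C b * substNone r Q₂) ^ j := by
  have substNone_C (c : K) : substNone r (MvPolynomial.C c) = MvPolynomial.C c := by
    simp [substNone, MvPolynomial.algebraMap_eq]
  have substNone_X : substNone r (MvPolynomial.X none) = r := by simp [substNone]
  simp only [newtonPoly, map_sub, map_mul, map_sum, map_pow, substNone_C, substNone_X, map_one]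

theorem IsSmall.newtonPoly [Nontrivial K] {B k M : ℕ} (hB : 2 ≤ B) (hM : M ≤ B)
    {Q₁ Q₂ : MvPolynomial (Option τ) K} (hQ₁ : IsSmall B k Q₁) (hQ₂ : IsSmall B k Q₂) (a b : K) :
    IsSmall B (k + 18) (newtonPoly Q₁ Q₂ a b M) := by
  have base : IsSmall B (k + 6) (MvPolynomial.C 1 - MvPolynomial.C b * Q₂) :=
    ((IsSmall.C 1).mono hB (k + 2).zero_le).sub hB (hQ₂.C_mul hB b)
  have series : IsSmall B (k + 12) (∑ j ∈ range M,
      MvPolynomial.C a * (MvPolynomial.C 1 - MvPolynomial.C b * Q₂) ^ j) :=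
    IsSmall.sum hB (by simpa using hM) fun j hj =>
      (base.pow hB ((mem_range.mp hj).le.trans hM)).C_mul hB a
  exact ((IsSmall.X none).mono hB (k + 14).zero_le).sub hB
    ((hQ₁.mono hB (by omega)).mul hB series)

/-- Dilation by a formal factor about the point `z`. -/
noncomputable def dilate (z : τ → K) : MvPolynomial τ K →ₐ[K] (MvPolynomial τ K)[X] :=
  MvPolynomial.aeval fun x =>
    C (MvPolynomial.C (z x)) + X * C (MvPolynomial.X x - MvPolynomial.C (z x))

theorem natDegree_dilate_le (z : τ → K) (f : MvPolynomial τ K) :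
    (dilate z f).natDegree ≤ f.totalDegree := by
  refine natDegree_aeval_le le_rfl fun x => natDegree_add_le_of_degree_le
    ((natDegree_C _).trans_le zero_le_one) (natDegree_mul_le.trans ?_)
  rw [natDegree_C, add_zero]
  exact natDegree_X_le

theorem eval_dilate (z : τ → K) (f r : MvPolynomial τ K) :
    (dilate z f).eval r = MvPolynomial.aeval
      (fun x => MvPolynomial.C (z x) + r * (MvPolynomial.X x - MvPolynomial.C (z x))) f := by
  have : ((Polynomial.aeval r).restrictScalars K).comp (dilate z) = MvPolynomial.aeval
      (fun x => MvPolynomial.C (z x) + r * (MvPolynomial.X x - MvPolynomial.C (z x))) :=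
    MvPolynomial.algHom_ext fun x => by simp [dilate]
  simpa [Polynomial.coe_aeval_eq_eval] using DFunLike.congr_fun this f

theorem eval_one_dilate (z : τ → K) (f : MvPolynomial τ K) : (dilate z f).eval 1 = f := by
  simp [eval_dilate]

theorem eval_zero_dilate (z : τ → K) (f : MvPolynomial τ K) :
    (dilate z f).eval 0 = MvPolynomial.C (MvPolynomial.eval z f) := by
  have : (MvPolynomial.aeval fun x => MvPolynomial.C (z x)) =
      (Algebra.ofId K (MvPolynomial τ K)).comp (MvPolynomial.aeval z) :=
    MvPolynomial.algHom_ext fun x => by simp [Algebra.ofId_apply, MvPolynomial.algebraMap_eq]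
  rw [eval_dilate]
  simpa using DFunLike.congr_fun this f

theorem X_pow_dvd_dilate {z : τ → K} {f : MvPolynomial τ K} {n : ℕ}
    (hf : f ∈ RingHom.ker (MvPolynomial.eval z) ^ n) : X ^ n ∣ dilate z f := by
  have map_le : (RingHom.ker (MvPolynomial.eval z)).map (dilate z) ≤ Ideal.span {X} :=
    Ideal.map_le_iff_le_comap.mpr fun g hg => Ideal.mem_span_singleton.mpr <| by
      rw [X_dvd_iff, coeff_zero_eq_eval_zero, eval_zero_dilate, RingHom.mem_ker.mp hg, map_zero]
  rw [← Ideal.mem_span_singleton, ← Ideal.span_singleton_pow]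
  exact Ideal.pow_right_mono map_le n (Ideal.map_pow (dilate z) _ n ▸ Ideal.mem_map_of_mem _ hf)

end CommRing

variable [Field K] [CharZero K] [Fintype τ]

theorem IsSmall.coeff_shiftNone {B k : ℕ} (hB : 2 ≤ B) (hτ : Fintype.card τ + 1 ≤ B)
    {Q : MvPolynomial (Option τ) K} (hQ : IsSmall B k Q) (hdeg : Q.totalDegree < B) (i : ℕ) :
    IsSmall B (k + 8) ((shiftNone Q).coeff i) := by
  rw [← sum_singleton (fun i => (shiftNone Q).coeff i) i]
  refine isSmall_sum_coeff (k := k + 4) hB ((natDegree_shiftNone_le Q).trans_lt hdeg)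
    (fun l => ?_) _
  rw [eval_shiftNone]
  refine hQ.aeval (l := 2) hB (by simpa using hτ) ?_
  rintro (_ | x)
  · exact (IsSmall.X none).add hB (IsSmall.C (l : K))
  · exact (IsSmall.X (some x)).mono hB zero_le_two

/-- A polynomial of degree at most `m` is recovered from an approximation of order
`m + 1` by interpolation along the lines through `z`. -/
theorem IsSmall.of_sub_mem_ker_pow {B m : ℕ} (hB : 2 ≤ B) (hτ : Fintype.card τ ≤ B) {z : τ → K}
    {p r : MvPolynomial τ K} (hp : p.totalDegree ≤ m) (hr : IsSmall B 1 r)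
    (hdeg : r.totalDegree < B) (h : r - p ∈ RingHom.ker (MvPolynomial.eval z) ^ (m + 1)) :
    IsSmall B 15 p := by
  have coeff_eq (i : ℕ) (hi : i ∈ range (m + 1)) : (dilate z p).coeff i = (dilate z r).coeff i := by
    have := X_pow_dvd_iff.mp (X_pow_dvd_dilate h) i (mem_range.mp hi)
    rwa [map_sub, coeff_sub, sub_eq_zero, eq_comm] at this
  have p_eq : p = ∑ i ∈ range (m + 1), (dilate z r).coeff i := by
    rw [← sum_congr rfl coeff_eq]
    conv_lhs => rw [← eval_one_dilate z p]
    simp [eval_eq_sum_range' (Nat.lt_succ_of_le ((natDegree_dilate_le z p).trans hp))]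
  rw [p_eq]
  refine isSmall_sum_coeff (k := 11) hB ((natDegree_dilate_le z r).trans_lt hdeg) (fun l => ?_) _
  rw [eval_dilate]
  refine hr.aeval (l := 8) hB hτ fun x => ?_
  have := ((IsSmall.X x).sub hB (IsSmall.C (z x))).C_mul hB (l : K)
  simpa using ((IsSmall.C (z x)).mono hB (Nat.zero_le 6)).add hB this

/-- Newton's iteration converges to the root `p` after `Q` has been replaced by a derivative with
respect to the distinguished variable of which `p` is a simple root. -/
theorem exists_isSmall_sub_mem_ker_pow {B k L : ℕ} (hB : 2 ≤ B) (hτ : Fintype.card τ + 1 ≤ B)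
    (hL : 2 ^ L ≤ B) {Q : MvPolynomial (Option τ) K} (hQ0 : Q ≠ 0) (hQ : IsSmall B k Q)
    (hdeg : Q.totalDegree < B) {p : MvPolynomial τ K} (hroot : substNone p Q = 0) :
    ∃ z : τ → K, ∃ r, IsSmall B ((k + 28) * L) r ∧
      r - p ∈ RingHom.ker (MvPolynomial.eval z) ^ 2 ^ L := by
  set q := MvPolynomial.optionEquivLeft K τ Q with hq
  obtain ⟨i, hi, hi'⟩ := exists_hasseDeriv_eval_eq_zero_and_succ_ne_zero (q := q) (p := p)
    (by simpa [hq] using hQ0) (by rw [hq, eval_optionEquivLeft, hroot])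
  have derivative_eval (r : MvPolynomial τ K) : (derivative (hasseDeriv i q)).eval r =
      ((i : MvPolynomial τ K) + 1) * substNone r ((shiftNone Q).coeff (i + 1)) := by
    rw [derivative_hasseDeriv, substNone_coeff_shiftNone, eval_smul, nsmul_eq_mul, Nat.cast_succ]
  have derivative_ne : (derivative (hasseDeriv i q)).eval p ≠ 0 := by
    rw [derivative_hasseDeriv, eval_smul]
    exact smul_ne_zero i.succ_ne_zero hi'
  obtain ⟨z, hz⟩ : ∃ z, MvPolynomial.eval z ((derivative (hasseDeriv i q)).eval p) ≠ 0 := by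
    by_contra! h
    exact derivative_ne (MvPolynomial.funext fun z => by simpa using h z)
  set δ := MvPolynomial.eval z ((derivative (hasseDeriv i q)).eval p) with hδ
  set G := newtonPoly ((shiftNone Q).coeff i) ((shiftNone Q).coeff (i + 1)) δ⁻¹ (δ⁻¹ * (i + 1))
    (2 ^ L)
  have substNone_G (r : MvPolynomial τ K) : substNone r G = r - (hasseDeriv i q).eval r *
      ∑ j ∈ range (2 ^ L), MvPolynomial.C δ⁻¹ *
        (1 - MvPolynomial.C δ⁻¹ * (derivative (hasseDeriv i q)).eval r) ^ j := by
    simp only [G, substNone_newtonPoly, derivative_eval, substNone_coeff_shiftNone, ← hq, map_mul,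
      map_add, map_natCast, map_one, mul_assoc]
  have isSmall_G : IsSmall B (k + 26) G :=
    (hQ.coeff_shiftNone hB hτ hdeg i).newtonPoly hB hL (hQ.coeff_shiftNone hB hτ hdeg (i + 1)) _ _
  suffices ∀ t ≤ L, ∃ r, IsSmall B ((k + 28) * t) r ∧
      r - p ∈ RingHom.ker (MvPolynomial.eval z) ^ 2 ^ t from ⟨z, this L le_rfl⟩
  intro t
  induction t with
  | zero => exact fun _ => ⟨MvPolynomial.C (MvPolynomial.eval z p), IsSmall.C _, by simp⟩
  | succ t ih =>
    intro ht
    obtain ⟨r, hr, hrp⟩ := ih (by omega)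
    refine ⟨substNone r G, (isSmall_G.substNone hB hτ hr).mono hB (by linarith), ?_⟩
    rw [substNone_G, pow_succ']
    exact newton_step _ hi (by simp [← hδ, hz]) Nat.one_le_two_pow
      (Nat.pow_le_pow_right two_pos (by omega)) hrp

/-- Kaltofen's theorem on factors, for factors of degree one in the distinguished variable. -/
theorem isSmall_root {B k m L : ℕ} (hB : 2 ≤ B) (hτ : Fintype.card τ + 1 ≤ B) (hmL : m < 2 ^ L)
    (hL : 2 ^ L ≤ B) {Q : MvPolynomial (Option τ) K} (hQ0 : Q ≠ 0) (hQ : IsSmall B k Q)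
    (hdeg : Q.totalDegree < B) {p : MvPolynomial τ K} (hp : p.totalDegree ≤ m)
    (hroot : substNone p Q = 0) : IsSmall B (((k + 28) * L + 1) * 15) p := by
  obtain ⟨z, r, hr, hrp⟩ := exists_isSmall_sub_mem_ker_pow hB hτ hL hQ0 hQ hdeg hroot
  have pow_lt : B ^ ((k + 28) * L) < B ^ ((k + 28) * L + 1) := Nat.pow_lt_pow_right hB (by omega)
  have le_pow : B ≤ B ^ ((k + 28) * L + 1) := Nat.le_self_pow (by omega) B
  refine IsSmall.pow_iff.mp (IsSmall.of_sub_mem_ker_pow (hB.trans le_pow) (by omega) hp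
    ⟨?_, ?_⟩ (hr.totalDegree_le.trans_lt pow_lt) (Ideal.pow_le_pow_right hmL hrp))
  · simpa using hr.totalDegree_le.trans pow_lt.le
  · simpa using hr.hasCircuitOfSize.mono pow_lt.le

end Roots

section Hybrid

open Finset

variable {K σ ι V A : Type*} [Field K]

theorem exists_hybrid [Infinite K] [Finite ι] [DecidableEq ι] [Nonempty A] {P : MvPolynomial ι K}
    (hP : P ≠ 0) {F : A → ι → K} (hF : ∀ α, MvPolynomial.eval (F α) P = 0) :
    ∃ T : Finset ι, ∃ e ∉ T, (∃ α β, MvPolynomial.eval (T.piecewise (F α) β) P ≠ 0) ∧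
      ∀ α β, MvPolynomial.eval ((insert e T).piecewise (F α) β) P = 0 := by
  have := Fintype.ofFinite ι
  by_contra! hstep
  have exists_ne (T : Finset ι) : ∃ α β, MvPolynomial.eval (T.piecewise (F α) β) P ≠ 0 := by
    induction T using Finset.induction_on with
    | empty =>
      by_contra! h
      exact hP (MvPolynomial.funext fun β => by simpa using h (Classical.arbitrary A) β)
    | insert e T he ih => exact hstep T e he ih
  obtain ⟨α, β, h⟩ := exists_ne univ
  exact h (by simpa using hF α)

/-- The polynomial `f` with the variables outside `A` set to the constants `a`. -/
noncomputable def restrictVars [DecidableEq σ] (A : Finset σ) (a : σ → K) :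
    MvPolynomial σ K →ₐ[K] MvPolynomial σ K :=
  MvPolynomial.aeval (A.piecewise MvPolynomial.X fun s => MvPolynomial.C (a s))

theorem eval_aeval (y : σ → K) (g : ι → MvPolynomial σ K) (P : MvPolynomial ι K) :
    MvPolynomial.eval y (MvPolynomial.aeval g P) =
      MvPolynomial.eval (fun e => MvPolynomial.eval y (g e)) P :=
  MvPolynomial.comp_aeval_apply g (MvPolynomial.aeval y) P

theorem eval_restrictVars [DecidableEq σ] (A : Finset σ) (a y : σ → K) (f : MvPolynomial σ K) :
    MvPolynomial.eval y (restrictVars A a f) = MvPolynomial.eval (A.piecewise y a) f := by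
  rw [restrictVars, eval_aeval]
  congr
  ext s
  by_cases hs : s ∈ A <;> simp [hs]

theorem eval_substNone (y : σ → K) (f : MvPolynomial σ K) (Q : MvPolynomial (Option σ) K) :
    MvPolynomial.eval y (substNone f Q) =
      MvPolynomial.eval (fun o => o.elim (MvPolynomial.eval y f) y) Q := by
  rw [substNone, eval_aeval]
  congr
  ext (_ | s) <;> simp

section HybridEntry

variable [Fintype σ] [DecidableEq σ] [DecidableEq ι] [DecidableEq V]

/-- The entries of a hybrid: on `T` they are the values of `f` on the parts of the table `α` that
are cut out by the design `h`, and elsewhere the constants `β`, except that the entry `e` is the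
variable `none`. The places of `α` that the design selects for `e` hold the variables `some s`. -/
noncomputable def hybridEntry (f : MvPolynomial σ K) (h : ι → σ → V) (α : σ → V → K) (β : ι → K)
    (T : Finset ι) (e : ι) : ι → MvPolynomial (Option σ) K :=
  T.piecewise (fun e' => MvPolynomial.rename some
      (restrictVars {s | h e' s = h e s} (fun s => α s (h e' s)) f))
    (Function.update (fun e' => MvPolynomial.C (β e')) e (MvPolynomial.X none))

theorem eval_hybridEntry (f : MvPolynomial σ K) (h : ι → σ → V) (α : σ → V → K) (β : ι → K)
    (T : Finset ι) (e : ι) (c : K) (y : σ → K) (e' : ι) :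
    MvPolynomial.eval (fun o => o.elim c y) (hybridEntry f h α β T e e') =
      T.piecewise (fun e' => MvPolynomial.eval
        (fun s => Function.update (α s) (h e s) (y s) (h e' s)) f) (Function.update β e c) e' := by
  by_cases hT : e' ∈ T
  · have update_eq : (fun s => Function.update (α s) (h e s) (y s) (h e' s)) =
        ({s | h e' s = h e s} : Finset σ).piecewise y fun s => α s (h e' s) := by
      ext s
      simp [Function.update_apply, Finset.piecewise]
    simp [hybridEntry, hT, update_eq, MvPolynomial.eval_rename, Function.comp_def,
      eval_restrictVars]
  · by_cases heq : e' = e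
    · subst heq
      simp [hybridEntry, hT]
    · simp [hybridEntry, hT, heq]

theorem isSmall_hybridEntry {B l r : ℕ} (hB : 2 ≤ B) (hσ : Fintype.card σ ≤ B)
    {f : MvPolynomial σ K}
    (hf : ∀ (A : Finset σ) (a : σ → K), #A ≤ r → IsSmall B l (restrictVars A a f))
    {h : ι → σ → V} (hh : Pairwise fun e e' => #{s | h e s = h e' s} ≤ r) (α : σ → V → K)
    (β : ι → K) {T : Finset ι} {e : ι} (he : e ∉ T) (e' : ι) :
    IsSmall B (l + 2) (hybridEntry f h α β T e e') := by
  by_cases hT : e' ∈ T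
  · have hne : e' ≠ e := fun heq => he (heq ▸ hT)
    simp only [hybridEntry, hT, piecewise_eq_of_mem, MvPolynomial.rename_eq_aeval]
    exact (hf _ _ (hh hne)).aeval hB hσ fun s => IsSmall.X (some s)
  · by_cases heq : e' = e
    · subst heq
      simpa [hybridEntry, hT] using (IsSmall.X none).mono hB (Nat.zero_le _)
    · simpa [hybridEntry, hT, heq] using (IsSmall.C (β e')).mono hB (Nat.zero_le _)

end HybridEntry

/-- Kabanets and Impagliazzo: an equation for the vectors whose entries are the values of `f` on the
almost disjoint parts of a table that are cut out by a design `h` yields an equation for `f`. -/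
theorem exists_isSmall_substNone_eq_zero [Infinite K] [Fintype σ] [DecidableEq σ] [Fintype ι]
    [DecidableEq V] {B k l r : ℕ} (hB : 2 ≤ B) (hσ : Fintype.card σ ≤ B) (hι : Fintype.card ι ≤ B)
    {f : MvPolynomial σ K}
    (hf : ∀ (A : Finset σ) (a : σ → K), #A ≤ r → IsSmall B l (restrictVars A a f))
    {h : ι → σ → V} (hh : Pairwise fun e e' => #{s | h e s = h e' s} ≤ r)
    {P : MvPolynomial ι K} (hP0 : P ≠ 0) (hP : IsSmall B k P)
    (hvan : ∀ α : σ → V → K,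
      MvPolynomial.eval (fun e => MvPolynomial.eval (fun s => α s (h e s)) f) P = 0) :
    ∃ Q, Q ≠ 0 ∧ substNone f Q = 0 ∧ IsSmall B (k + (l + 2) + 2) Q := by
  classical
  obtain ⟨T, e, he, ⟨α, β, hne⟩, hzero⟩ := exists_hybrid hP0 hvan
  refine ⟨MvPolynomial.aeval (hybridEntry f h α β T e) P, fun h0 => hne ?_,
    MvPolynomial.funext fun y => ?_, hP.aeval hB hι (isSmall_hybridEntry hB hσ hf hh α β he)⟩
  · rw [← map_zero (MvPolynomial.eval fun o : Option σ => o.elim (β e) fun s => α s (h e s)), ← h0,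
      eval_aeval]
    simp only [eval_hybridEntry, Function.update_eq_self]
  · rw [map_zero, eval_substNone, eval_aeval,
      ← hzero (fun s => Function.update (α s) (h e s) (y s)) β]
    congr
    ext e'
    rw [eval_hybridEntry]
    by_cases heq : e' = e
    · subst heq
      simp [he]
    · by_cases hT : e' ∈ T <;> simp [hT, heq]

theorem isSmall_restrictVars_sum_prod_X [Fintype ι] [DecidableEq σ] {B r : ℕ} (hB : 2 ≤ B)
    (hr : 2 ^ r ≤ B) (S : ι → Finset σ) (A : Finset σ) (a : σ → K) (hA : #A ≤ r) :
    IsSmall B 6 (restrictVars A a (∑ i, ∏ s ∈ S i, MvPolynomial.X s)) := by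
  have restrict_term (i : ι) : restrictVars A a (∏ s ∈ S i, MvPolynomial.X s) =
      MvPolynomial.C (∏ s ∈ S i with s ∉ A, a s) * ∏ s ∈ A ∩ S i, MvPolynomial.X s := by
    simp only [restrictVars, map_prod, MvPolynomial.aeval_X, Finset.piecewise, prod_ite]
    rw [mul_comm, filter_mem_eq_inter, inter_comm]
  have collect : restrictVars A a (∑ i, ∏ s ∈ S i, MvPolynomial.X s) =
      ∑ U ∈ A.powerset, MvPolynomial.C (∑ i with A ∩ S i = U, ∏ s ∈ S i with s ∉ A, a s) *
        ∏ s ∈ U, MvPolynomial.X s := by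
    rw [map_sum, sum_congr rfl fun i _ => restrict_term i,
      ← sum_fiberwise_of_maps_to (g := fun i => A ∩ S i)
        fun i _ => mem_powerset.mpr inter_subset_left]
    refine sum_congr rfl fun U _ => ?_
    rw [map_sum, sum_mul]
    exact sum_congr rfl fun i hi => by rw [(mem_filter.mp hi).2]
  rw [collect]
  refine IsSmall.sum hB ?_ fun U hU => .C_mul hB _ (.prod hB ?_ fun s _ => .X s)
  · rw [card_powerset]
    exact (Nat.pow_le_pow_right two_pos hA).trans hr
  · exact (card_le_card (mem_powerset.mp hU)).trans (hA.trans (r.lt_two_pow_self.le.trans hr))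

theorem permPoly_eq_sum_prod_X (m : ℕ) : permPoly K m =
    ∑ π : Equiv.Perm (Fin m), ∏ s ∈ univ.image fun i => (π i, i), MvPolynomial.X s := by
  refine sum_congr rfl fun π _ => ?_
  rw [prod_image fun i _ j _ hij => congrArg Prod.snd hij]
  rfl

theorem totalDegree_permPoly_le (m : ℕ) : (permPoly K m).totalDegree ≤ m := by
  refine MvPolynomial.totalDegree_finsetSum_le fun π _ => ?_
  refine (MvPolynomial.totalDegree_finsetProd _ _).trans ?_
  simp [Matrix.mvPolynomialX]

end Hybrid

section Design

open Finset

theorem card_filter_sum_mul_pow_eq_lt {R κ : Type*} [CommRing R] [IsDomain R] [DecidableEq R]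
    [Fintype κ] {n : ℕ} {c : κ → R} (hc : Function.Injective c) {a b : Fin n → R} (hab : a ≠ b) :
    #{x | ∑ l, a l * c x ^ (l : ℕ) = ∑ l, b l * c x ^ (l : ℕ)} < n := by
  by_contra! hn
  obtain ⟨φ⟩ : Nonempty (Fin n ↪ {x // ∑ l, a l * c x ^ (l : ℕ) = ∑ l, b l * c x ^ (l : ℕ)}) :=
    Function.Embedding.nonempty_of_card_le (by simpa [Fintype.card_subtype] using hn)
  refine hab (sub_eq_zero.mp <| Matrix.eq_zero_of_forall_index_sum_mul_pow_eq_zero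
    (f := fun j => c (φ j)) (hc.comp (Subtype.val_injective.comp φ.injective)) fun j => ?_)
  simp only [Pi.sub_apply, sub_mul, sum_sub_distrib, (φ j).2, sub_self]

end Design

section ExponentialSums

open Finset

variable {K σ τ I V : Type*} [Field K] [Fintype I] [Fintype V]
  {B k : ℕ}

/-- The interpolation polynomial that takes the values `β 0, …, β E` at `0, …, E`, applied to `x`.
Since `β` is arbitrary, it decodes an integer that has been encoded in Boolean variables. -/
noncomputable def lookup (β : ℕ → K) (E : ℕ) (x : MvPolynomial σ K) : MvPolynomial σ K :=
  Polynomial.aeval x (Lagrange.interpolate (range (E + 1)) (Nat.cast : ℕ → K) β)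

theorem lookup_natCast [CharZero K] (β : ℕ → K) {E κ : ℕ} (hκ : κ ≤ E) :
    lookup β E (κ : MvPolynomial σ K) = MvPolynomial.C (β κ) := by
  have := Lagrange.eval_interpolate_at_node β (Nat.cast_injective (R := K)).injOn
    (mem_range.mpr (Nat.lt_succ_of_le hκ))
  rw [lookup, ← map_natCast (algebraMap K (MvPolynomial σ K)), Polynomial.aeval_algebraMap_apply,
    Polynomial.coe_aeval_eq_eval, this, MvPolynomial.algebraMap_eq]

theorem map_lookup (φ : MvPolynomial σ K →ₐ[K] MvPolynomial τ K) (β : ℕ → K) (E : ℕ)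
    (x : MvPolynomial σ K) : φ (lookup β E x) = lookup β E (φ x) :=
  (Polynomial.aeval_algHom_apply φ x _).symm

theorem IsSmall.lookup [CharZero K] (hB : 2 ≤ B) (β : ℕ → K) {E : ℕ} (hE : E < B)
    {x : MvPolynomial σ K} (hx : IsSmall B k x) : IsSmall B (k + 6) (lookup β E x) := by
  refine hx.polynomial_aeval hB (lt_of_le_of_lt ?_ hE)
  have := Lagrange.degree_interpolate_le β
    (Nat.cast_injective (R := K)).injOn (s := range (E + 1))
  rw [card_range, Nat.add_sub_cancel] at this
  exact Polynomial.natDegree_le_of_degree_le this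

/-- For Boolean values `u`, the indicator of the event that exactly one of them is `1`. -/
noncomputable def oneHotTest (u : V → MvPolynomial σ K) : MvPolynomial σ K :=
  lookup (fun κ => if κ = 1 then 1 else 0) (Fintype.card V) (∑ v, u v)

theorem oneHotTest_ite [CharZero K] (p : V → Prop) [DecidablePred p] [Decidable (∃! v, p v)] :
    oneHotTest (fun v => if p v then 1 else 0 : V → MvPolynomial σ K) =
      if ∃! v, p v then 1 else 0 := by
  rw [oneHotTest, sum_boole, lookup_natCast _ (card_le_univ _)]
  simp only [← Fintype.existsUnique_iff_card_one, apply_ite MvPolynomial.C, map_one, map_zero]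

theorem map_oneHotTest (φ : MvPolynomial σ K →ₐ[K] MvPolynomial τ K) (u : V → MvPolynomial σ K) :
    φ (oneHotTest u) = oneHotTest fun v => φ (u v) := by
  rw [oneHotTest, map_lookup, map_sum, oneHotTest]

theorem IsSmall.oneHotTest [CharZero K] (hB : 2 ≤ B) (hV : Fintype.card V < B)
    {u : V → MvPolynomial σ K} (hu : ∀ v, IsSmall B k (u v)) :
    IsSmall B (k + 8) (oneHotTest u) :=
  (IsSmall.sum hB hV.le fun v _ => hu v).lookup hB _ hV

theorem sum_prod_oneHotTest_mul [CharZero K] [DecidableEq I] [DecidableEq V]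
    (F : (I × V → MvPolynomial σ K) → MvPolynomial σ K) :
    ∑ u : I × V → Bool, (∏ i, oneHotTest fun v => if u (i, v) then 1 else 0) *
        F (fun p => if u p then 1 else 0) =
      ∑ f : I → V, F fun p => if f p.1 = p.2 then 1 else 0 := by
  classical
  simp only [oneHotTest_ite, prod_ite_zero, prod_const_one, mem_univ, true_imp_iff]
  symm
  refine Fintype.sum_of_injective (fun (f : I → V) p => decide (f p.1 = p.2)) ?_ _ _ ?_ ?_
  · intro f f' h
    ext i
    simpa using (congrFun h (i, f' i))
  · intro u hu
    rw [if_neg, zero_mul]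
    intro h
    choose f hf huniq using h
    refine hu ⟨f, funext fun ⟨i, v⟩ => Bool.eq_iff_iff.mpr ?_⟩
    rw [decide_eq_true_iff]
    exact ⟨fun hfv => congrArg (fun v => u (i, v)) hfv ▸ hf i, fun huv => (huniq i v huv).symm⟩
  · intro f
    simp

/-- The summand of the permanent of `M` as an exponential sum over Boolean square matrices `w`,
which is nonzero only if `w` is the matrix of a permutation. -/
noncomputable def permanentTerm (w : V × V → MvPolynomial σ K) (M : Matrix V V (MvPolynomial σ K)) :
    MvPolynomial σ K :=
  (∏ i, oneHotTest fun j => w (i, j)) *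
    ((∏ j, oneHotTest fun i => w (i, j)) * ∏ i, ∑ j, w (i, j) * M j i)

theorem permanent_eq_sum_permanentTerm [CharZero K] [DecidableEq V]
    (M : Matrix V V (MvPolynomial σ K)) :
    M.permanent = ∑ w : V × V → Bool, permanentTerm (fun p => if w p then 1 else 0) M := by
  classical
  simp only [permanentTerm]
  rw [sum_prod_oneHotTest_mul fun w => (∏ j, oneHotTest fun i => w (i, j)) *
    ∏ i, ∑ j, w (i, j) * M j i]
  simp only [oneHotTest_ite, prod_ite_zero, prod_const_one, mem_univ, true_imp_iff, ite_mul,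
    one_mul, zero_mul, sum_ite_eq, if_true, ← Function.bijective_iff_existsUnique]
  refine Fintype.sum_of_injective (fun π : Equiv.Perm V => (π : V → V)) DFunLike.coe_injective
    _ _ ?_ ?_
  · intro f hf
    exact if_neg fun h => hf ⟨Equiv.ofBijective f h, rfl⟩
  · intro π
    simp

theorem map_permanentTerm (φ : MvPolynomial σ K →ₐ[K] MvPolynomial τ K)
    (w : V × V → MvPolynomial σ K) (M : Matrix V V (MvPolynomial σ K)) :
    φ (permanentTerm w M) = permanentTerm (fun p => φ (w p)) (M.map φ) := by
  simp only [permanentTerm, map_mul, map_prod, map_sum, map_oneHotTest, Matrix.map_apply]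

theorem IsSmall.permanentTerm [CharZero K] (hB : 2 ≤ B) (hV : Fintype.card V < B)
    {w : V × V → MvPolynomial σ K} (hw : ∀ p, IsSmall B 0 (w p))
    {M : Matrix V V (MvPolynomial σ K)} (hM : ∀ i j, IsSmall B k (M i j)) :
    IsSmall B (k + 14) (permanentTerm w M) := by
  refine IsSmall.mul hB (k := k + 12) (IsSmall.mono (k := 10) hB ?_ (by omega))
    (IsSmall.mul hB (k := k + 10) (IsSmall.mono (k := 10) hB ?_ (by omega))
      (IsSmall.mono (k := k + 6) hB ?_ (by omega)))
  · exact IsSmall.prod hB hV.le fun i _ => IsSmall.oneHotTest hB hV fun j => hw (i, j)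
  · exact IsSmall.prod hB hV.le fun j _ => IsSmall.oneHotTest hB hV fun i => hw (i, j)
  · exact IsSmall.prod hB hV.le fun i _ => IsSmall.sum hB hV.le fun j _ =>
      ((hw (i, j)).mono hB k.zero_le).mul hB (hM j i)

/-- If `u` is the indicator of the graph of `f : I → V`, then the value of `β` at the integer
`∑ i, h i (f i)`. -/
noncomputable def graphLookup (β : ℕ → K) (h : I → V → ℕ) (u : I × V → MvPolynomial σ K) :
    MvPolynomial σ K :=
  lookup β (∑ i, ∑ v, h i v) (∑ i, ∑ v, u (i, v) * (h i v : MvPolynomial σ K))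

theorem graphLookup_ite [CharZero K] [DecidableEq V] (β : ℕ → K) (h : I → V → ℕ) (f : I → V) :
    graphLookup β h (fun p => if f p.1 = p.2 then 1 else 0 : I × V → MvPolynomial σ K) =
      MvPolynomial.C (β (∑ i, h i (f i))) := by
  simp only [graphLookup, ite_mul, one_mul, zero_mul, sum_ite_eq, mem_univ, if_true]
  rw [← Nat.cast_sum, lookup_natCast]
  exact sum_le_sum fun i _ => single_le_sum (fun _ _ => Nat.zero_le _) (mem_univ (f i))

theorem map_graphLookup (φ : MvPolynomial σ K →ₐ[K] MvPolynomial τ K) (β : ℕ → K) (h : I → V → ℕ)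
    (u : I × V → MvPolynomial σ K) :
    φ (graphLookup β h u) = graphLookup β h fun p => φ (u p) := by
  simp only [graphLookup, map_lookup, map_sum, map_mul, map_natCast]

theorem IsSmall.graphLookup [CharZero K] (hB : 2 ≤ B) (hI : Fintype.card I ≤ B)
    (hV : Fintype.card V ≤ B) (β : ℕ → K) {h : I → V → ℕ} (hh : ∑ i, ∑ v, h i v < B)
    {u : I × V → MvPolynomial σ K} (hu : ∀ p, IsSmall B k (u p)) :
    IsSmall B (k + 12) (graphLookup β h u) := by
  refine (IsSmall.sum hB hI fun i _ => IsSmall.sum hB hV fun v _ =>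
    (hu (i, v)).mul hB ?_).lookup hB β hh
  simpa using (IsSmall.C (h i v : K)).mono hB k.zero_le

theorem boolSum_mem_VNPSlice {J : Type*} [Fintype J] [DecidableEq J] {n c d : ℕ} (hB : 2 ≤ B)
    (hJ : n + Fintype.card J ≤ B) (hc : B ^ (k + 2) ≤ n ^ c) {g : MvPolynomial (Fin n ⊕ J) K}
    (hg : IsSmall B k g) {f : MvPolynomial (Fin n) K} (hf : f.totalDegree ≤ d)
    (hfg : f = ∑ b : J → Bool,
      MvPolynomial.aeval (Sum.elim MvPolynomial.X fun j => if b j then 1 else 0) g) :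
    f ∈ VNPSlice K c n d := by
  let e := Fintype.equivFin J
  have isSmall_rename : IsSmall B (k + 2) (MvPolynomial.rename (Sum.map id e) g) := by
    rw [MvPolynomial.rename_eq_aeval]
    exact hg.aeval hB (by simpa using hJ) fun x => IsSmall.X _
  have card_le : Fintype.card J ≤ B ^ (k + 2) :=
    (by omega : Fintype.card J ≤ B).trans (Nat.le_self_pow (by omega) B)
  refine ⟨hf, Fintype.card J, MvPolynomial.rename (Sum.map id e) g, card_le.trans hc,
    isSmall_rename.totalDegree_le.trans hc, isSmall_rename.hasCircuitOfSize.mono hc, ?_⟩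
  rw [hfg, boolSum]
  refine Fintype.sum_equiv (e.arrowCongr (Equiv.refl Bool)) _ _ fun b => ?_
  rw [MvPolynomial.aeval_rename, Sum.elim_comp_map]
  congr
  ext1 j
  simp [Equiv.arrowCongr]

end ExponentialSums

section Slice

open Finset

variable {K V σ τ : Type*} [Field K] [Fintype V] {B n : ℕ}

/-- The exponent vector with entries `v`. -/
noncomputable def toExponent (v : Fin n → Fin (n + 1)) : Fin n →₀ ℕ :=
  Finsupp.equivFunOnFinite.symm fun l => (v l : ℕ)

theorem toExponent_injective : Function.Injective (toExponent (n := n)) := fun _ _ h =>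
  funext fun l => Fin.ext (DFunLike.congr_fun h l)

theorem degree_toExponent (v : Fin n → Fin (n + 1)) : (toExponent v).degree = ∑ l, (v l : ℕ) :=
  Finsupp.degree_eq_sum _

theorem exists_toExponent_eq {d : ℕ} (hd : d ≤ n) (e : MonIdx n d) : ∃ v, toExponent v = e.1 :=
  ⟨fun l => ⟨e.1 l, Nat.lt_succ_of_le (((Finsupp.le_degree l e.1).trans e.2).trans hd)⟩,
    Finsupp.ext fun _ => rfl⟩

/-- If `u` is the indicator of the graph of an exponent vector, then the monomial in `x` with this
exponent vector, or zero if its degree exceeds `d`. -/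
noncomputable def monomialTerm (d : ℕ) (u : Fin n × Fin (n + 1) → MvPolynomial σ K)
    (x : Fin n → MvPolynomial σ K) : MvPolynomial σ K :=
  graphLookup (fun κ => if κ ≤ d then (1 : K) else 0)
      (fun (_ : Fin n) (v : Fin (n + 1)) => (v : ℕ)) u *
    ∏ l, ∑ v : Fin (n + 1), u (l, v) * x l ^ (v : ℕ)

theorem monomialTerm_ite [CharZero K] (d : ℕ) (v : Fin n → Fin (n + 1)) :
    monomialTerm d (fun p => if v p.1 = p.2 then 1 else 0) MvPolynomial.X =
      MvPolynomial.monomial (toExponent v) (if (toExponent v).degree ≤ d then (1 : K) else 0) := by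
  rw [monomialTerm, graphLookup_ite, MvPolynomial.monomial_eq, degree_toExponent,
    Finsupp.prod_fintype _ _ (by simp)]
  simp [toExponent]

theorem map_monomialTerm (φ : MvPolynomial σ K →ₐ[K] MvPolynomial τ K) (d : ℕ)
    (u : Fin n × Fin (n + 1) → MvPolynomial σ K) (x : Fin n → MvPolynomial σ K) :
    φ (monomialTerm d u x) = monomialTerm d (fun p => φ (u p)) fun l => φ (x l) := by
  simp only [monomialTerm, map_mul, map_prod, map_sum, map_pow, map_graphLookup]

theorem IsSmall.monomialTerm [CharZero K] (hB : (n + 1) ^ 3 < B) (d : ℕ)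
    {u : Fin n × Fin (n + 1) → MvPolynomial σ K} (hu : ∀ p, IsSmall B 0 (u p))
    {x : Fin n → MvPolynomial σ K} (hx : ∀ l, IsSmall B 0 (x l)) :
    IsSmall B 14 (monomialTerm d u x) := by
  have two_le : 2 ≤ B := (Nat.one_le_pow 3 (n + 1) n.succ_pos).trans_lt hB
  have succ_le : n + 1 ≤ B := (Nat.le_self_pow (by norm_num) _).trans hB.le
  have sum_lt : ∑ _l : Fin n, ∑ v : Fin (n + 1), (v : ℕ) < B := by
    calc _ ≤ ∑ _l : Fin n, ∑ _v : Fin (n + 1), (n + 1) := by gcongr; omega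
      _ = n * ((n + 1) * (n + 1)) := by simp
      _ ≤ (n + 1) * ((n + 1) * (n + 1)) := by gcongr; omega
      _ = (n + 1) ^ 3 := by ring
      _ < B := hB
  refine IsSmall.mul two_le (k := 12)
    (IsSmall.graphLookup two_le (by simp; omega) (by simpa using succ_le) _ sum_lt hu)
    (IsSmall.mono (k := 8) two_le ?_ (by norm_num))
  exact IsSmall.prod two_le (by simp; omega) fun l _ =>
    IsSmall.sum two_le (by simpa using succ_le) fun v _ =>
      ((hu (l, v)).mono two_le (Nat.zero_le 2)).mul two_le ((hx l).pow two_le (by omega))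

/-- The permanent of a matrix whose entries are looked up in tables at an integer determined by the
exponents that are encoded in Boolean variables, times the monomial with these exponents. -/
noncomputable def permanentSummand (d : ℕ) (h : V → V → Fin n → Fin (n + 1) → ℕ)
    (β : V → V → ℕ → K) : MvPolynomial (Fin n ⊕ ((Fin n × Fin (n + 1)) ⊕ (V × V))) K :=
  let u := fun p => MvPolynomial.X (Sum.inr (Sum.inl p))
  let w := fun p => MvPolynomial.X (Sum.inr (Sum.inr p))
  (∏ l, oneHotTest fun v => u (l, v)) * (monomialTerm d u (fun l => MvPolynomial.X (Sum.inl l)) *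
    permanentTerm w (Matrix.of fun i j => graphLookup (β i j) (h i j) u))

theorem sum_permanentSummand [CharZero K] [DecidableEq V] (d : ℕ)
    (h : V → V → Fin n → Fin (n + 1) → ℕ) (β : V → V → ℕ → K) :
    ∑ b : (Fin n × Fin (n + 1)) ⊕ (V × V) → Bool, MvPolynomial.aeval
        (Sum.elim MvPolynomial.X fun j => if b j then 1 else 0) (permanentSummand d h β) =
      ∑ v, MvPolynomial.monomial (toExponent v) (if (toExponent v).degree ≤ d then
        Matrix.permanent (Matrix.of fun i j => β i j (∑ l, h i j l (v l))) else 0) := by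
  let F (u : Fin n × Fin (n + 1) → MvPolynomial (Fin n) K) : MvPolynomial (Fin n) K :=
    monomialTerm d u MvPolynomial.X *
      Matrix.permanent (Matrix.of fun i j => graphLookup (β i j) (h i j) u)
  calc _ = ∑ u : Fin n × Fin (n + 1) → Bool, (∏ l, oneHotTest fun v => if u (l, v) then 1 else 0) *
        F fun p => if u p then 1 else 0 := ?_
    _ = ∑ v : Fin n → Fin (n + 1), F fun p => if v p.1 = p.2 then 1 else 0 :=
        sum_prod_oneHotTest_mul F
    _ = _ := sum_congr rfl fun v _ => ?_
  · simp only [F, permanent_eq_sum_permanentTerm, mul_sum]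
    rw [← Fintype.sum_prod_type']
    refine Fintype.sum_equiv (Equiv.sumArrowEquivProdArrow _ _ _) _ _ fun b => ?_
    simp only [permanentSummand, map_mul, map_prod, map_oneHotTest, map_monomialTerm,
      map_permanentTerm, MvPolynomial.aeval_X, Sum.elim_inl, Sum.elim_inr]
    congr 3
    ext1 i j
    simp only [Matrix.map_apply, Matrix.of_apply, map_graphLookup, MvPolynomial.aeval_X,
      Sum.elim_inr]
    rfl
  · simp only [F, graphLookup_ite, monomialTerm_ite, Matrix.permanent, Matrix.of_apply,
      ← map_prod, ← map_sum, mul_comm _ (MvPolynomial.C _),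
      MvPolynomial.C_mul_monomial, mul_ite, mul_one, mul_zero]

theorem isSmall_permanentSummand [CharZero K] (hB : (n + 1) ^ 3 + Fintype.card V ^ 2 < B) (d : ℕ)
    {h : V → V → Fin n → Fin (n + 1) → ℕ} (hh : ∀ i j, ∑ l, ∑ v, h i j l v < B)
    (β : V → V → ℕ → K) : IsSmall B 30 (permanentSummand d h β) := by
  have two_le : 2 ≤ B := by have := Nat.one_le_pow 3 (n + 1) n.succ_pos; omega
  have succ_lt : n + 1 < B := by have := Nat.le_self_pow (n := 3) (by norm_num) (n + 1); omega
  have card_lt : Fintype.card V < B := by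
    have := Nat.le_self_pow (n := 2) (by norm_num) (Fintype.card V); omega
  rw [permanentSummand]
  refine IsSmall.mul two_le (k := 28) (IsSmall.mono (k := 10) two_le ?_ (by norm_num))
    (IsSmall.mul two_le (k := 26) (IsSmall.mono (k := 14) two_le ?_ (by norm_num)) ?_)
  · exact IsSmall.prod two_le (by simp; omega) fun l _ =>
      IsSmall.oneHotTest two_le (by simpa using succ_lt) fun v => IsSmall.X _
  · exact IsSmall.monomialTerm (by omega) d (fun p => IsSmall.X _) fun l => IsSmall.X _
  · refine IsSmall.permanentTerm (k := 12) two_le card_lt (fun p => IsSmall.X _) fun i j => ?_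
    rw [Matrix.of_apply]
    exact IsSmall.graphLookup two_le (by simp; omega) (by simpa using succ_lt.le) _ (hh i j)
      fun p => IsSmall.X _

theorem exists_mem_VNPSlice [CharZero K] [DecidableEq V] {c d : ℕ}
    (hB : (n + 1) ^ 3 + Fintype.card V ^ 2 < B) (hc : B ^ 32 ≤ n ^ c)
    {h : V → V → Fin n → Fin (n + 1) → ℕ} (hh : ∀ i j, ∑ l, ∑ v, h i j l v < B)
    (β : V → V → ℕ → K) :
    ∃ f ∈ VNPSlice K c n d, ∀ (e : MonIdx n d) (v : Fin n → Fin (n + 1)), toExponent v = e.1 →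
      coeffVec d f e = Matrix.permanent (Matrix.of fun i j => β i j (∑ l, h i j l (v l))) := by
  have two_le : 2 ≤ B := by have := Nat.one_le_pow 3 (n + 1) n.succ_pos; omega
  have card_le : n + Fintype.card ((Fin n × Fin (n + 1)) ⊕ (V × V)) ≤ B := by
    simp only [Fintype.card_sum, Fintype.card_prod, Fintype.card_fin]
    ring_nf at hB ⊢
    omega
  refine ⟨_, boolSum_mem_VNPSlice two_le card_le hc (isSmall_permanentSummand hB d hh β) ?_
    (sum_permanentSummand d h β).symm, fun e v hv => ?_⟩
  · refine MvPolynomial.totalDegree_finsetSum_le fun v _ => ?_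
    split_ifs with hv
    · exact (MvPolynomial.totalDegree_monomial_le _ _).trans hv
    · simp
  · simp only [coeffVec, MvPolynomial.coeff_sum, MvPolynomial.coeff_monomial, ← hv,
      toExponent_injective.eq_iff, sum_ite_eq', mem_univ, if_true]
    exact if_pos (hv ▸ e.2)

end Slice

section Slice

open Finset

variable {K : Type*} [Field K]

theorem eval_permPoly {m : ℕ} (y : Fin m × Fin m → K) :
    MvPolynomial.eval y (permPoly K m) = Matrix.permanent (Matrix.of fun i j => y (i, j)) := by
  simp only [permPoly, Matrix.permanent, Matrix.mvPolynomialX_apply, map_sum, map_prod,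
    MvPolynomial.eval_X, Matrix.of_apply]

instance (n d : ℕ) : Finite (MonIdx n d) :=
  (Finsupp.finite_of_degree_le d).to_subtype

theorem card_monIdx_le {n d : ℕ} (hd : d ≤ n) [Fintype (MonIdx n d)] :
    Fintype.card (MonIdx n d) ≤ (n + 1) ^ n := by
  choose v hv using exists_toExponent_eq hd
  have := Fintype.card_le_of_injective v fun e e' h => Subtype.ext (by rw [← hv e, ← hv e', h])
  simpa using this

theorem exists_mem_VNPSlice_coeffVec_eq_eval_permPoly [CharZero K] {q n m d c D : ℕ} [NeZero q]
    (hq : q ≤ 2 * (m ^ 2 + n + 1)) (hD : 2 * (n + 1) ^ 2 * (m ^ 2 + n + 1) < D)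
    (hc : D ^ 32 ≤ n ^ c)
    (x : Fin m × Fin m → ZMod q) (α : Fin m × Fin m → ZMod q → K) :
    ∃ f ∈ VNPSlice K c n d, ∀ (e : MonIdx n d) (v : Fin n → Fin (n + 1)), toExponent v = e.1 →
      coeffVec d f e = MvPolynomial.eval
        (fun s => α s (∑ l, ((v l : ℕ) : ZMod q) * x s ^ (l : ℕ))) (permPoly K m) := by
  let h (i j : Fin m) (l : Fin n) (v : Fin (n + 1)) : ℕ :=
    (((v : ℕ) : ZMod q) * x (i, j) ^ (l : ℕ)).val
  have sum_lt (i j) : ∑ l, ∑ v, h i j l v < D := by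
    calc _ ≤ ∑ _l : Fin n, ∑ _v : Fin (n + 1), q := by
          gcongr
          exact (ZMod.val_lt _).le
      _ = n * ((n + 1) * q) := by simp
      _ ≤ (n + 1) * ((n + 1) * (2 * (m ^ 2 + n + 1))) := by gcongr; omega
      _ = 2 * (n + 1) ^ 2 * (m ^ 2 + n + 1) := by ring
      _ < D := hD
  obtain ⟨f, hf, coeff_eq⟩ := exists_mem_VNPSlice (d := d) (V := Fin m)
    (lt_of_le_of_lt (by rw [Fintype.card_fin]; ring_nf; omega) hD) hc sum_lt
    fun i j κ => α (i, j) (κ : ZMod q)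
  refine ⟨f, hf, fun e v hv => ?_⟩
  simp only [coeff_eq e v hv, eval_permPoly, h, Nat.cast_sum, ZMod.natCast_val, ZMod.cast_id', id]

theorem exists_isSmall_substNone_permPoly_eq_zero [CharZero K] {n m d c D B k : ℕ} (hd : d ≤ n)
    (hD : 2 * (n + 1) ^ 2 * (m ^ 2 + n + 1) < D) (hc : D ^ 32 ≤ n ^ c) (hB : 2 ≤ B) (hm : m ^ 2 ≤ B)
    (hn : 2 ^ n ≤ B) (hι : (n + 1) ^ n ≤ B) {P : MvPolynomial (MonIdx n d) K} (hP0 : P ≠ 0)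
    (hP : IsSmall B k P) (hvan : ∀ f ∈ VNPSlice K c n d, VanishesAt P f) :
    ∃ Q, Q ≠ 0 ∧ substNone (permPoly K m) Q = 0 ∧ IsSmall B (k + 10) Q := by
  have : Fintype (MonIdx n d) := Fintype.ofFinite _
  obtain ⟨q, q_prime, lt_q, q_le⟩ := Nat.exists_prime_lt_and_le_two_mul (m ^ 2 + n + 1) (by omega)
  have : Fact q.Prime := ⟨q_prime⟩
  obtain ⟨x⟩ : Nonempty (Fin m × Fin m ↪ ZMod q) := by
    refine Function.Embedding.nonempty_of_card_le ?_
    rw [Fintype.card_prod, Fintype.card_fin, ZMod.card]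
    nlinarith
  choose v hv using exists_toExponent_eq hd
  have natCast_injective : Function.Injective fun a : Fin (n + 1) => ((a : ℕ) : ZMod q) :=
    fun a b h => Fin.ext (by
      rwa [ZMod.natCast_eq_natCast_iff', Nat.mod_eq_of_lt (by omega), Nat.mod_eq_of_lt (by omega)]
        at h)
  refine exists_isSmall_substNone_eq_zero (r := n) (l := 6) hB (by simpa [sq] using hm)
    ((card_monIdx_le hd).trans hι) (fun A a hA => ?_)
    (h := fun e s => ∑ l, ((v e l : ℕ) : ZMod q) * x s ^ (l : ℕ)) (fun e e' hne => ?_) hP0 hP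
    fun α => ?_
  · rw [permPoly_eq_sum_prod_X]
    exact isSmall_restrictVars_sum_prod_X hB hn _ A a hA
  · refine (card_filter_sum_mul_pow_eq_lt x.injective fun h => hne (Subtype.ext ?_)).le
    rw [← hv e, ← hv e', funext fun l => natCast_injective (congrFun h l)]
  · obtain ⟨f, hf, coeff_eq⟩ :=
      exists_mem_VNPSlice_coeffVec_eq_eval_permPoly (d := d) q_le hD hc x α
    rw [← funext fun e => coeff_eq e (v e) (hv e)]
    exact hvan f hf

theorem isSmall_permPoly_of_vanishesAt [CharZero K] {n m d c D B : ℕ} (hd : d ≤ n)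
    (hD : 2 * (n + 1) ^ 2 * (m ^ 2 + n + 1) < D) (hc : D ^ 32 ≤ n ^ c) (hB : 2 ≤ B) (hm : m < 2 ^ n)
    (hmB : m ^ 2 < B) (hn : 2 ^ n ≤ B) (hι : (n + 1) ^ n ≤ B) {P : MvPolynomial (MonIdx n d) K}
    (hP0 : P ≠ 0) (hP : IsSmall B 1 P) (hvan : ∀ f ∈ VNPSlice K c n d, VanishesAt P f) :
    IsSmall B (180 * (29 * n + 1)) (permPoly K m) := by
  obtain ⟨Q, hQ0, hroot, hQ⟩ :=
    exists_isSmall_substNone_permPoly_eq_zero hd hD hc hB hmB.le hn hι hP0 hP hvan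
  have le_pow : B ≤ B ^ 12 := Nat.le_self_pow (by norm_num) B
  have isSmall_Q : IsSmall (B ^ 12) 1 Q := IsSmall.pow_iff.mpr (hQ.mono hB (by norm_num))
  have degree_lt : Q.totalDegree < B ^ 12 :=
    hQ.totalDegree_le.trans_lt (Nat.pow_lt_pow_right hB (by norm_num))
  have := isSmall_root (hB.trans le_pow) (by simpa [sq] using hmB.trans_le le_pow) hm
    (hn.trans le_pow) hQ0 isSmall_Q degree_lt (totalDegree_permPoly_le m) hroot
  exact (IsSmall.pow_iff.mp this).mono hB (by ring_nf; rfl)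

end Slice

section Asymptotics

open Filter

theorem two_mul_sq_mul_lt_pow {n m b : ℕ} (hn : 3 ≤ n) (hm : m ≤ (n + 1) ^ b) :
    2 * (n + 1) ^ 2 * (m ^ 2 + n + 1) < n ^ (4 * b + 8) := by
  have sq_le : m ^ 2 ≤ (n + 1) ^ (2 * b + 1) :=
    calc m ^ 2 ≤ ((n + 1) ^ b) ^ 2 := by gcongr
      _ = (n + 1) ^ (2 * b) := by rw [← pow_mul, mul_comm]
      _ ≤ (n + 1) ^ (2 * b + 1) := Nat.pow_le_pow_right n.succ_pos (Nat.le_succ _)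
  have succ_le : n + 1 ≤ (n + 1) ^ (2 * b + 1) := Nat.le_self_pow (by omega) _
  calc _ ≤ 2 * (n + 1) ^ 2 * (2 * (n + 1) ^ (2 * b + 1)) := by gcongr; omega
    _ = 4 * (n + 1) ^ (2 * b + 3) := by ring
    _ < n ^ 2 * (n ^ 2) ^ (2 * b + 3) := by gcongr <;> nlinarith
    _ = n ^ (4 * b + 8) := by rw [← pow_mul, ← pow_add]; congr 1; ring

theorem eventually_add_one_pow_lt_two_pow (b : ℕ) : ∀ᶠ n : ℕ in atTop, (n + 1) ^ b < 2 ^ n := by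
  have tendsto_zero := (tendsto_pow_const_div_const_pow_of_one_lt b
    (one_lt_two : (1 : ℝ) < 2)).comp (tendsto_add_atTop_nat 1)
  filter_upwards [tendsto_zero.eventually_lt_const (by norm_num : (0 : ℝ) < 1 / 2)] with n hn
  rw [Function.comp_apply, div_lt_iff₀ (by positivity), pow_succ' (2 : ℝ)] at hn
  exact_mod_cast (by linarith : ((n + 1 : ℕ) : ℝ) ^ b < 2 ^ n)

theorem choose_pow_le_two_pow {n d j E : ℕ} (hd : d ≤ n) (hj : 2 * j ≤ E) :
    (n + d).choose n ^ j ≤ 2 ^ (E * n ^ 2) :=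
  calc (n + d).choose n ^ j ≤ (2 ^ (2 * n)) ^ j := by
        gcongr
        exact (Nat.choose_le_two_pow _ _).trans (Nat.pow_le_pow_right two_pos (by omega))
    _ = 2 ^ (2 * j * n) := by rw [← pow_mul]; ring_nf
    _ ≤ 2 ^ (E * n ^ 2) := by gcongr <;> [norm_num; exact Nat.le_self_pow two_ne_zero n]

theorem exists_eventually_hasCircuitOfSize_permPoly (K : Type*) [Field K] [CharZero K] (b : ℕ) :
    ∃ c : ℕ, ∀ a k : ℕ, ∀ᶠ n : ℕ in atTop, ∀ m d : ℕ, m ≤ (n + 1) ^ b → d ≤ n →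
      ∀ P : MvPolynomial (MonIdx n d) K, P ≠ 0 → P.totalDegree ≤ (n + d).choose n ^ a →
        HasCircuitOfSize P ((n + d).choose n ^ k) → (∀ f ∈ VNPSlice K c n d, VanishesAt P f) →
          ∃ t < 2 ^ n ^ 4, HasCircuitOfSize (permPoly K m) t := by
  refine ⟨(4 * b + 8) * 32, fun a k => ?_⟩
  let E := 2 * a + 2 * k + 2
  filter_upwards [eventually_gt_atTop (5400 * E), eventually_add_one_pow_lt_two_pow b] with n hn
    pow_lt m d hm hd P hP0 hP_deg hP_size hvan
  have le_sq : n ≤ n ^ 2 := Nat.le_self_pow two_ne_zero n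
  have two_pow_le {j l : ℕ} (hj : j ≤ E) (hl : l ≤ j * n ^ 2) : 2 ^ l ≤ 2 ^ (E * n ^ 2) :=
    Nat.pow_le_pow_right two_pos (hl.trans (Nat.mul_le_mul_right _ hj))
  have m_lt : m < 2 ^ n := hm.trans_lt pow_lt
  have isSmall_perm := isSmall_permPoly_of_vanishesAt (D := n ^ (4 * b + 8)) (m := m)
    (B := 2 ^ (E * n ^ 2)) hd (two_mul_sq_mul_lt_pow (by omega) hm) (pow_mul _ _ _).ge
    (two_pow_le (j := 1) (l := 1) (by omega) (by nlinarith)) m_lt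
    ((Nat.pow_lt_pow_left m_lt two_ne_zero).trans_le
      (by rw [← pow_mul]; exact two_pow_le (j := 2) (by omega) (by nlinarith)))
    (two_pow_le (j := 1) (by omega) (by omega))
    ((Nat.pow_le_pow_left (Nat.lt_two_pow_self (n := n)) n).trans
      (by rw [← pow_mul]; exact two_pow_le (j := 1) (by omega) (by nlinarith)))
    hP0 ⟨by simpa using hP_deg.trans (choose_pow_le_two_pow hd (by omega)),
      hP_size.mono (by simpa using choose_pow_le_two_pow hd (by omega))⟩ hvan
  refine ⟨_, ?_, isSmall_perm.hasCircuitOfSize⟩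
  rw [← pow_mul]
  refine Nat.pow_lt_pow_right one_lt_two ?_
  calc E * n ^ 2 * (180 * (29 * n + 1)) ≤ E * n ^ 2 * (180 * (30 * n)) := by gcongr; omega
    _ = 5400 * E * n ^ 3 := by ring
    _ < n * n ^ 3 := Nat.mul_lt_mul_of_pos_right hn (Nat.pow_pos (by omega))
    _ = n ^ 4 := by ring

theorem tendsto_numVars {ε : ℝ} (hε : 0 < ε) : Tendsto (numVars ε) atTop atTop :=
  tendsto_nat_floor_atTop.comp
    ((tendsto_rpow_atTop (by positivity)).comp tendsto_natCast_atTop_atTop)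

theorem le_numVars_add_one_pow {ε : ℝ} (hε : 0 < ε) (m : ℕ) :
    m ≤ (numVars ε m + 1) ^ ⌈4 / ε⌉₊ := by
  have real_le : (m : ℝ) ≤ ((numVars ε m : ℝ) + 1) ^ ⌈4 / ε⌉₊ :=
    calc (m : ℝ) = ((m : ℝ) ^ (ε / 4)) ^ (4 / ε) := by
          rw [← Real.rpow_mul m.cast_nonneg, div_mul_div_cancel₀ four_ne_zero, div_self hε.ne',
            Real.rpow_one]
      _ ≤ ((numVars ε m : ℝ) + 1) ^ (4 / ε) :=
          Real.rpow_le_rpow (by positivity) (Nat.lt_floor_add_one _).le (by positivity)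
      _ ≤ ((numVars ε m : ℝ) + 1) ^ (⌈4 / ε⌉₊ : ℝ) :=
          Real.rpow_le_rpow_of_exponent_le (by simp) (Nat.le_ceil _)
      _ = _ := Real.rpow_natCast _ _
  exact_mod_cast real_le

theorem numVars_pow_four_le (ε : ℝ) (m : ℕ) : (numVars ε m : ℝ) ^ 4 ≤ (m : ℝ) ^ ε :=
  calc (numVars ε m : ℝ) ^ 4 ≤ ((m : ℝ) ^ (ε / 4)) ^ 4 := by
        gcongr
        exact Nat.floor_le (by positivity)
    _ = (m : ℝ) ^ ε := by
        rw [← Real.rpow_natCast, ← Real.rpow_mul m.cast_nonneg]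
        norm_num

theorem RequiresSize.two_pow_numVars_pow_four_le {K σ : Type*} [CommRing K]
    {f : MvPolynomial σ K} {ε : ℝ} {m t : ℕ} (hf : RequiresSize f ((2 : ℝ) ^ ((m : ℝ) ^ ε)))
    (ht : HasCircuitOfSize f t) : 2 ^ numVars ε m ^ 4 ≤ t := by
  obtain ⟨C, hC, size_le⟩ := ht
  have real_le : (2 : ℝ) ^ (numVars ε m ^ 4) ≤ (t : ℝ) :=
    calc (2 : ℝ) ^ (numVars ε m ^ 4) = (2 : ℝ) ^ ((numVars ε m : ℝ) ^ 4) := by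
          rw [← Real.rpow_natCast, Nat.cast_pow]
      _ ≤ (2 : ℝ) ^ ((m : ℝ) ^ ε) :=
          Real.rpow_le_rpow_of_exponent_le one_le_two (numVars_pow_four_le ε m)
      _ ≤ C.size := hf C hC
      _ ≤ t := by exact_mod_cast size_le
  exact_mod_cast real_le

theorem exists_eventually_requiresSize (K : Type*) [Field K] [CharZero K] {ε : ℝ} (hε : 0 < ε) :
    ∃ c : ℕ, ∀ a k : ℕ, ∀ᶠ m : ℕ in atTop,
      RequiresSize (permPoly K m) ((2 : ℝ) ^ ((m : ℝ) ^ ε)) →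
      ∀ n d N : ℕ, n = numVars ε m → d ≤ n → N = (n + d).choose n →
        ∀ P : MvPolynomial (MonIdx n d) K, P ≠ 0 → P.totalDegree ≤ N ^ a →
          (∀ f ∈ VNPSlice K c n d, VanishesAt P f) → RequiresSize P ((N : ℝ) ^ k) := by
  obtain ⟨c, hc⟩ := exists_eventually_hasCircuitOfSize_permPoly K ⌈4 / ε⌉₊
  refine ⟨c, fun a k => ?_⟩
  filter_upwards [(tendsto_numVars hε).eventually (hc a k)] with m hm hhard
  rintro _ d _ rfl hd rfl P hP0 hdeg hvan C hC
  by_contra! size_lt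
  obtain ⟨t, t_lt, hperm⟩ := hm m d (le_numVars_add_one_pow hε m) hd P hP0 hdeg
    ⟨C, hC, by exact_mod_cast size_lt.le⟩ hvan
  exact (hhard.two_pow_numVars_pow_four_le hperm).not_gt t_lt

theorem memVNP_of_mem_VNPSlice {K : Type*} [CommRing K] {c : ℕ}
    {f : (n : ℕ) → MvPolynomial (Fin n) K} (hf : ∀ n, f n = 0 ∨ ∃ d, f n ∈ VNPSlice K c n d) :
    MemVNP f := by
  have exists_boolSum (n : ℕ) : ∃ (k : ℕ) (g : MvPolynomial (Fin n ⊕ Fin k) K), f n = boolSum g ∧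
      (1 ≤ n → k ≤ n ^ c ∧ g.totalDegree ≤ n ^ c ∧ HasCircuitOfSize g (n ^ c)) := by
    rcases hf n with h | ⟨d, -, k, g, hk, hdeg, hsize, h⟩
    · refine ⟨0, 0, by simp [h, boolSum], fun hn => ⟨Nat.zero_le _, by simp, ?_⟩⟩
      simpa using (hasCircuitOfSize_C (0 : K)).mono (Nat.one_le_pow c n hn)
    · exact ⟨k, g, h, fun _ => ⟨hk, hdeg, hsize⟩⟩
  choose k g hfg hbound using exists_boolSum
  refine ⟨k, g, ⟨c, ?_⟩, ⟨c, ?_⟩, hfg⟩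
  · filter_upwards [eventually_ge_atTop 1] with n hn using (hbound n hn).2
  · filter_upwards [eventually_ge_atTop 1] with n hn using (hbound n hn).1

theorem exists_frequently_of_frequently_exists {ν : ℕ → ℕ} (hν : Tendsto ν atTop atTop)
    {β : ℕ → Type*} [∀ n, Nonempty (β n)] {p : (m : ℕ) → β (ν m) → Prop}
    (hp : ∃ᶠ m in atTop, ∃ b, p m b) : ∃ f : (n : ℕ) → β n, ∃ᶠ m in atTop, p m (f (ν m)) := by
  have exists_value (n : ℕ) : ∃ b : β n, (∃ m, ν m = n ∧ ∃ b', p m b') →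
      ∃ (m : ℕ) (h : n = ν m), p m (h ▸ b) := by
    by_cases hn : ∃ m, ν m = n ∧ ∃ b', p m b'
    · obtain ⟨m, rfl, b, hb⟩ := hn
      exact ⟨b, fun _ => ⟨m, rfl, hb⟩⟩
    · exact ⟨Classical.arbitrary _, fun h => absurd h hn⟩
  choose f hf using exists_value
  refine ⟨f, frequently_atTop.mpr fun M => ?_⟩
  obtain ⟨m₀, hm₀, lt_ν⟩ := (hp.and_eventually (hν.eventually_gt_atTop
    ((Finset.range M).sup ν))).exists
  obtain ⟨m, hm, hpm⟩ := hf (ν m₀) ⟨m₀, rfl, hm₀⟩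
  refine ⟨m, ?_, ?_⟩
  · by_contra! lt_M
    exact (hm ▸ lt_ν).not_ge (Finset.le_sup (f := ν) (Finset.mem_range.mpr lt_M))
  · have subst_eq : ∀ {n} (h : n = ν m), p m (h ▸ f n) → p m (f (ν m)) := by
      rintro _ rfl h
      exact h
    exact subst_eq hm hpm

theorem eventually_forall_mem_VNPSlice_of_memVNP {K : Type*} [CommRing K] {ν : ℕ → ℕ}
    (hν : Tendsto ν atTop atTop) (c : ℕ) {d : ℕ → ℕ} {H : ℕ → Prop}
    {p : (m : ℕ) → MvPolynomial (Fin (ν m)) K → Prop}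
    (hp : ∀ f : (n : ℕ) → MvPolynomial (Fin n) K, MemVNP f →
      ∀ᶠ m : ℕ in atTop, H m → (f (ν m)).totalDegree ≤ d m → p m (f (ν m))) :
    ∀ᶠ m : ℕ in atTop, H m → ∀ f ∈ VNPSlice K c (ν m) (d m), p m f := by
  by_contra hfreq
  let β (n : ℕ) := {f : MvPolynomial (Fin n) K // f = 0 ∨ ∃ d, f ∈ VNPSlice K c n d}
  have (n : ℕ) : Nonempty (β n) := ⟨⟨0, Or.inl rfl⟩⟩
  obtain ⟨f, hf⟩ := exists_frequently_of_frequently_exists hν (β := β)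
    (p := fun m f => H m ∧ f.1.totalDegree ≤ d m ∧ ¬p m f.1)
    ((not_eventually.mp hfreq).mono fun m hm => by
      push Not at hm
      obtain ⟨hH, f, hf, hne⟩ := hm
      exact ⟨⟨f, Or.inr ⟨d m, hf⟩⟩, hH, hf.1, hne⟩)
  obtain ⟨m, ⟨hH, hdeg, hne⟩, hpm⟩ :=
    (hf.and_eventually (hp (fun n => (f n).1) (memVNP_of_mem_VNPSlice fun n => (f n).2))).exists
  exact hne (hpm hH hdeg)

end Asymptotics

end VNPEquations

open VNPEquations Filter in
theorem theorem1p2_general (K : Type*) [Field K] [CharZero K] (ε : ℝ) (hε : 0 < ε) :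
    (∃ c : ℕ, ∀ a k : ℕ, ∀ᶠ m : ℕ in atTop,
      RequiresSize (permPoly K m) ((2 : ℝ) ^ ((m : ℝ) ^ ε)) →
      ∀ n d N : ℕ, n = numVars ε m → d ≤ n → N = (n + d).choose n →
        ∀ P : MvPolynomial (MonIdx n d) K, P ≠ 0 → P.totalDegree ≤ N ^ a →
          (∀ f ∈ VNPSlice K c n d, VanishesAt P f) →
            RequiresSize P ((N : ℝ) ^ k)) ∧
    (∀ (d : ℕ → ℕ) (P : (m : ℕ) → MvPolynomial (MonIdx (numVars ε m) (d m)) K) (a : ℕ),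
      (∀ m, d m ≤ numVars ε m) →
      (∀ m, P m ≠ 0) →
      (∀ᶠ m : ℕ in atTop, (P m).totalDegree ≤ ((numVars ε m + d m).choose (numVars ε m)) ^ a) →
      (∀ f : (n : ℕ) → MvPolynomial (Fin n) K, MemVNP f →
        ∀ᶠ m : ℕ in atTop, RequiresSize (permPoly K m) ((2 : ℝ) ^ ((m : ℝ) ^ ε)) →
          (f (numVars ε m)).totalDegree ≤ d m → VanishesAt (P m) (f (numVars ε m))) →
      ∀ k : ℕ, ∀ᶠ m : ℕ in atTop, RequiresSize (permPoly K m) ((2 : ℝ) ^ ((m : ℝ) ^ ε)) →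
        RequiresSize (P m) ((((numVars ε m + d m).choose (numVars ε m) : ℕ) : ℝ) ^ k)) := by
  obtain ⟨c, hc⟩ := exists_eventually_requiresSize K hε
  refine ⟨⟨c, hc⟩, fun d P a hd hP0 hdeg hvan k => ?_⟩
  filter_upwards [hc a k, hdeg,
    eventually_forall_mem_VNPSlice_of_memVNP (tendsto_numVars hε) c hvan] with m hm hdeg_m hvan_m
    hhard
  exact hm hhard _ _ _ rfl (hd m) rfl (P m) (hP0 m) hdeg_m (hvan_m hhard)

open VNPEquations Filter in
/-- The first part is the statement for each large `m` for which `Perm_m` is hard, with `VNP(n, d)`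
cut off at a polynomial bound `n ^ c` whose exponent depends on `ε` only. The second part is the
statement for families `(P_m)` against families in `VNP`. In both, `size(P) = N ^ ω(1)` is asserted
as `size(P) ≥ N ^ k` for every `k` and all large `m`, for `P` of degree polynomial in `N`. -/
theorem theorem1p2 (ε : ℝ) (hε : 0 < ε) :
    (∃ c : ℕ, ∀ a k : ℕ, ∀ᶠ m : ℕ in atTop, PermHard ε m →
      ∀ n d N : ℕ, n = numVars ε m → d ≤ n → N = (n + d).choose n →
        ∀ P : MvPolynomial (MonIdx n d) ℂ, P ≠ 0 → P.totalDegree ≤ N ^ a →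
          (∀ f ∈ VNPSlice ℂ c n d, VanishesAt P f) →
            RequiresSize P ((N : ℝ) ^ k)) ∧
    (∀ (d : ℕ → ℕ) (P : (m : ℕ) → MvPolynomial (MonIdx (numVars ε m) (d m)) ℂ) (a : ℕ),
      (∀ m, d m ≤ numVars ε m) →
      (∀ m, P m ≠ 0) →
      (∀ᶠ m : ℕ in atTop, (P m).totalDegree ≤ ((numVars ε m + d m).choose (numVars ε m)) ^ a) →
      (∀ f : (n : ℕ) → MvPolynomial (Fin n) ℂ, MemVNP f →
        ∀ᶠ m : ℕ in atTop, PermHard ε m →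
          (f (numVars ε m)).totalDegree ≤ d m → VanishesAt (P m) (f (numVars ε m))) →
      ∀ k : ℕ, ∀ᶠ m : ℕ in atTop, PermHard ε m →
        RequiresSize (P m) ((((numVars ε m + d m).choose (numVars ε m) : ℕ) : ℝ) ^ k)) :=
  theorem1p2_general ℂ ε hε
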